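/- Throughout, graphs are finite and simple, and a rooted graph $(G,i)$ is a graph $G$ with a designated root vertex $i$ (rooted graphs are considered up to isomorphism). For a graph $G$ on $n$ vertices, let $\mathcal{S}(G)$ be the set of real symmetric $n\times n$ matrices whose off-diagonal $(a,b)$-entry is nonzero if and only if $\{a,b\}$ is an edge of $G$ (the diagonal is arbitrary). For $A\in\mathcal{S}(G)$, let $A(i)$ be obtained from $A$ by deleting row and column $i$; the $i$-nullity pair of $A$ is $(\operatorname{null}(A),\operatorname{null}(A(i)))$. The matrix $A$ has the $i$-strong nullity interlacing property ($i$-SNIP) if $X=O$ is the only real symmetric matrix such that $A\circ X=I\circ X=O$ (entrywise products) and all rows of $AX$ except possibly the $i$-th are zero. Let $\xi\xi(G,i)$ be the maximum of $k+\ell$ over all pairs $k\le\ell$ such that some $A\in\mathcal{S}(G)$ with $i$-SNIP has $i$-nullity pair $(k,\ell)$. A proper rooted minor of $(G,i)$ is a rooted graph obtained from $(G,i)$ by one or more of the following operations: removing an edge, removing a vertex that is not the root, or contracting an edge (discarding loops and merging parallel edges), where the new vertex becomes the root if the contracted edge is incident to the root. A rooted graph $(G,i)$ is a minimal minor for $\xi\xi\ge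 s$ if $\xi\xi(G,i)\ge s$ and every proper rooted minor $(F,r)$ of $(G,i)$ satisfies $\xi\xi(F,r)<s$. A rooted graph $(G,i)$ is obtained from $(H,j)$ by extending the root if $G$ is obtained from $H$ by adding a new vertex $i$ adjacent only to $j$, and $i$ is made the root. Theorem. For each integer $k\ge 0$, the minimal minors for $\xi\xi\ge 2k+1$ are exactly the rooted graphs obtained from the minimal minors for $\xi\xi\ge 2k$ by extending their roots. -/

import Mathlib

universe u

/-- A (finite) rooted graph: a finite simple graph with a designated root vertex. -/
structure RootedGraph where
  V : Type u
  [fintype : Fintype V]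
  graph : SimpleGraph V
  root : V

attribute [instance] RootedGraph.fintype

/-- The nullity of a real square matrix: the dimension of its kernel. -/
noncomputable def nullity {V : Type*} [Fintype V] (A : Matrix V V ℝ) : ℕ :=
  Module.finrank ℝ (LinearMap.ker A.mulVecLin)

/-- `A(i)`: the principal submatrix obtained by removing row and column `i`. -/
def deleteIndex {V : Type*} (A : Matrix V V ℝ) (i : V) :
    Matrix {v // v ≠ i} {v // v ≠ i} ℝ :=
  A.submatrix Subtype.val Subtype.val

/-- The matrices associated to `G`: real symmetric, with the off-diagonal `(a, b)`-entry nonzero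
if and only if `a` and `b` are adjacent; the diagonal is arbitrary. -/
def IsGraphMatrix {V : Type*} (G : SimpleGraph V) (A : Matrix V V ℝ) : Prop :=
  A.IsSymm ∧ ∀ a b, a ≠ b → (A a b ≠ 0 ↔ G.Adj a b)

open Classical in
/-- The `i`-strong nullity interlacing property: `X = 0` is the only symmetric matrix with
`A ∘ X = I ∘ X = 0` such that `A X` vanishes once its `i`-th row is removed. -/
def HasSNIP {V : Type*} [Fintype V] (A : Matrix V V ℝ) (i : V) : Prop :=
  ∀ X : Matrix V V ℝ, X.IsSymm → Matrix.hadamard A X = 0 →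
    Matrix.hadamard (1 : Matrix V V ℝ) X = 0 →
    (A * X).submatrix (Subtype.val : {v // v ≠ i} → V) id = 0 → X = 0

namespace RootedGraph

open Classical in
/-- The rooted graph allows the nullity pair `(k, l)` with the strong nullity interlacing
property at its root. -/
def AllowsSNIP (R : RootedGraph.{u}) (k l : ℕ) : Prop :=
  ∃ A : Matrix R.V R.V ℝ, IsGraphMatrix R.graph A ∧ nullity A = k ∧
    nullity (deleteIndex A R.root) = l ∧ HasSNIP A R.root

/-- The sums `k + l` over the pairs `k ≤ l` that the rooted graph allows with SNIP. -/
def pairSums (R : RootedGraph.{u}) : Set ℕ :=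
  {s | ∃ k l, k ≤ l ∧ R.AllowsSNIP k l ∧ s = k + l}

/-- The parameter `ξξ(G, i)`, the maximum of `k + l` over the pairs `k ≤ l` that `(G, i)` allows
with SNIP. The maximum is attained: see `isGreatest_xixi`. -/
noncomputable def xixi (R : RootedGraph.{u}) : ℕ := sSup R.pairSums

theorem pairSums_bddAbove (R : RootedGraph.{u}) : BddAbove R.pairSums := by
  classical
  refine ⟨Fintype.card R.V + Fintype.card R.V, ?_⟩
  rintro s ⟨k, l, -, ⟨A, -, rfl, rfl, -⟩, rfl⟩
  have h1 : nullity A ≤ Fintype.card R.V :=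
    (Submodule.finrank_le _).trans (by simp)
  have h2 : nullity (deleteIndex A R.root) ≤ Fintype.card {v // v ≠ R.root} :=
    (Submodule.finrank_le _).trans (by simp)
  have h3 : Fintype.card {v // v ≠ R.root} ≤ Fintype.card R.V := Fintype.card_subtype_le _
  omega

theorem allowsSNIP_zero_zero (R : RootedGraph.{u}) : R.AllowsSNIP 0 0 := by
  classical
  have hpos : ((R.graph.lapMatrix ℝ + 1 : Matrix R.V R.V ℝ)).PosDef :=
    Matrix.PosDef.posSemidef_add (SimpleGraph.posSemidef_lapMatrix ℝ R.graph) Matrix.PosDef.one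
  have hnull : ∀ {W : Type u} [Fintype W] (B : Matrix W W ℝ), B.PosDef → nullity B = 0 := by
    intro W _ B hB
    have : LinearMap.ker B.mulVecLin = ⊥ := by
      rw [Matrix.ker_mulVecLin_eq_bot_iff]
      intro v hv
      by_contra hne
      have := hB.dotProduct_mulVec_pos hne
      simp [hv] at this
    unfold nullity
    rw [this]; simp
  set A := (R.graph.lapMatrix ℝ + 1 : Matrix R.V R.V ℝ) with hA
  have hsymm : A.IsSymm := (SimpleGraph.isSymm_lapMatrix ℝ R.graph).add Matrix.isSymm_one
  refine ⟨A, ⟨hsymm, ?_⟩, hnull A hpos, ?_, ?_⟩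
  · intro a b hab
    simp [hA, SimpleGraph.lapMatrix, SimpleGraph.degMatrix,
      SimpleGraph.adjMatrix_apply, hab]
  · exact hnull _ (hpos.submatrix Subtype.val_injective)
  · intro X hX _ hdiag hrow
    have hx : ∀ v b, v ≠ R.root → (A * X) v b = 0 := fun v b hv =>
      congrFun (congrFun hrow ⟨v, hv⟩) b
    have hd : X R.root R.root = 0 := by
      have := congrFun (congrFun hdiag R.root) R.root
      simpa using this
    have key : ∀ a b, (X * (A * X)) a b = X a R.root * (A * X) R.root b := by
      intro a b
      rw [Matrix.mul_apply, Finset.sum_eq_single R.root]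
      · intro v _ hv; rw [hx v b hv, mul_zero]
      · simp
    have hsq : ∀ b, X R.root b = 0 → ∀ a, X a b = 0 := by
      intro b hb a
      by_contra hne
      have hc : (fun c => X c b) ≠ 0 := fun h => hne (congrFun h a)
      have h1 := hpos.dotProduct_mulVec_pos hc
      have h2 : star (fun c => X c b) ⬝ᵥ A.mulVec (fun c => X c b) = (X * (A * X)) b b := by
        rw [Matrix.mul_apply]
        refine Finset.sum_congr rfl fun c _ => ?_
        rw [← hX.apply b c]
        rfl
      rw [h2, key, hX.apply, hb, zero_mul] at h1
      exact lt_irrefl _ h1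
    have hroot : ∀ b, X R.root b = 0 := by
      intro b
      rw [← hX.apply]
      exact hsq _ hd b
    ext a b
    exact hsq b (hroot b) a

theorem isGreatest_xixi (R : RootedGraph.{u}) : IsGreatest R.pairSums R.xixi :=
  ⟨Nat.sSup_mem ⟨0, 0, 0, le_rfl, R.allowsSNIP_zero_zero, rfl⟩ R.pairSums_bddAbove,
    fun _ hs => le_csSup R.pairSums_bddAbove hs⟩

/-- Isomorphism of rooted graphs. -/
def IsIso (R S : RootedGraph.{u}) : Prop :=
  ∃ e : R.graph ≃g S.graph, e R.root = S.root

/-- `Step R S`: up to isomorphism, `S` is obtained from `R` by one operation, namely removing an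
edge, removing a vertex that is not the root, or contracting an edge `ab` of `R`. In the last case
`f` is the contraction map: it identifies exactly `a` with `b`, the adjacencies of `S` are the
images of those of `R` (loops dropped, parallel edges merged), and the root goes to the root. -/
inductive Step : RootedGraph.{u} → RootedGraph.{u} → Prop
  | deleteEdge {R S : RootedGraph.{u}} (a b : R.V) (hab : R.graph.Adj a b)
      (e : S.graph ≃g R.graph.deleteEdges {s(a, b)}) (he : e S.root = R.root) : Step R S
  | deleteVertex {R S : RootedGraph.{u}} (v : R.V) (hv : v ≠ R.root)
      (e : S.graph ≃g R.graph.induce {w | w ≠ v}) (he : (e S.root : R.V) = R.root) : Step R S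
  | contractEdge {R S : RootedGraph.{u}} (a b : R.V) (hab : R.graph.Adj a b)
      (f : R.V → S.V) (hf : Function.Surjective f)
      (hfib : ∀ x y, f x = f y ↔ x = y ∨ (x = a ∧ y = b) ∨ (x = b ∧ y = a))
      (hadj : ∀ x y, S.graph.Adj x y ↔ x ≠ y ∧ ∃ p q, f p = x ∧ f q = y ∧ R.graph.Adj p q)
      (hroot : f R.root = S.root) : Step R S

/-- `S` is a proper rooted minor of `R`: it is obtained from `R` by one or more operations. -/
def IsProperMinor (S R : RootedGraph.{u}) : Prop := Relation.TransGen Step R S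

/-- `R` is a minimal minor for `ξξ ≥ s`. -/
def IsMinimalMinor (R : RootedGraph.{u}) (s : ℕ) : Prop :=
  s ≤ R.xixi ∧ ∀ S : RootedGraph.{u}, S.IsProperMinor R → S.xixi < s

/-- Extending the root: append a new leaf (`none`) to the root and make it the new root. -/
def extendRoot (R : RootedGraph.{u}) : RootedGraph.{u} where
  V := Option R.V
  graph := R.graph.map some ⊔ SimpleGraph.edge none (some R.root)
  root := none

end RootedGraph

/-!
Removing the root `r` from a matrix changes the nullity by at most one, so every pair `(k, l)` with
`k ≤ l` is `(k, k)` or `(k, k + 1)`. If the pair is `(k, k)`, changing the diagonal entry at `r`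
produces a matrix with the strong Arnold property, of nullity `k + 1`, with a kernel vector that is
nonzero at `r`. The strong Arnold property says that the congruence orbit of this matrix meets the
matrices of the graph transversally. When `k ≥ 1` this allows a small perturbation, within the
matrices of the graph, after which the pair is `(k - 1, k)`. Hence `ξξ ≥ 2k + 1` if and only if some
pair `(m, m + 1)` with `m ≥ k` is allowed.

If the pair is `(k, k + 1)`, then `A(r)` has the strong Arnold property and a kernel vector that is
not orthogonal to the column of `A` at `r`, hence nonzero at some neighbor `j` of `r`; conversely,
any such matrix on `G - r` can be bordered. So `(G, r)` allows `(k, k + 1)` if and only if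
`(G - r, j)` allows `(k, k)` for some neighbor `j` of `r`. Write `S⁺` for the extension of the root
of `S`: it allows `(k, k + 1)` if and only if `S` allows `(k, k)`, and `(G, r)` contains
`(G - r, j)⁺` as a rooted minor. The theorem follows because a proper minor of `S⁺` is `T⁺` for a
proper minor `T` of `S`, or a minor of `S`, or has an isolated root, which excludes pairs
`(k, k + 1)`.
-/

open Matrix

section Nullity

variable {V W : Type*} [Fintype V] [Fintype W]

theorem finrank_inf_ker_add_one {K E : Type*} [Field K] [AddCommGroup E] [Module K E]
    [FiniteDimensional K E] {U : Submodule K E} {φ : E →ₗ[K] K} {x : E} (hx : x ∈ U)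
    (hφ : φ x ≠ 0) :
    Module.finrank K (U ⊓ LinearMap.ker φ : Submodule K E) + 1 = Module.finrank K U := by
  have hne : φ.domRestrict U ≠ 0 := fun h => hφ (LinearMap.congr_fun h ⟨x, hx⟩)
  rw [← Module.Dual.finrank_ker_add_one_of_ne_zero (f := φ.domRestrict U) hne,
    ← Submodule.map_comap_subtype, Submodule.finrank_map_subtype_eq]
  rfl

theorem nullity_add_rank (A : Matrix V V ℝ) : A.rank + nullity A = Fintype.card V := by
  rw [← Module.finrank_fintype_fun_eq_card ℝ]
  exact LinearMap.finrank_range_add_finrank_ker A.mulVecLin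

theorem nullity_eq_of_rank_eq {A : Matrix V V ℝ} {B : Matrix W W ℝ}
    (hcard : Fintype.card V = Fintype.card W) (hrank : A.rank = B.rank) :
    nullity A = nullity B := by
  have hA := nullity_add_rank A
  have hB := nullity_add_rank B
  omega

theorem nullity_submatrix (A : Matrix W W ℝ) (e : V ≃ W) : nullity (A.submatrix e e) = nullity A :=
  nullity_eq_of_rank_eq (Fintype.card_congr e) (rank_submatrix A e e)

theorem nullity_transpose_mul_mul [DecidableEq V] {Z : Matrix V V ℝ} (hZ : IsUnit Z)
    (A : Matrix V V ℝ) : nullity (Zᵀ * A * Z) = nullity A := by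
  have hdet : IsUnit Z.det := (isUnit_iff_isUnit_det Z).1 hZ
  refine nullity_eq_of_rank_eq rfl ?_
  rw [rank_mul_eq_left_of_isUnit_det _ _ hdet,
    rank_mul_eq_right_of_isUnit_det _ _ (by rwa [det_transpose])]

theorem vecMul_eq_mulVec_of_isSymm {α : Type*} [CommSemiring α] {A : Matrix V V α}
    (hA : A.IsSymm) (x : V → α) : x ᵥ* A = A *ᵥ x := by
  rw [← mulVec_transpose, hA.eq]

theorem dotProduct_mulVec_eq_mulVec_dotProduct {α : Type*} [CommSemiring α] {A : Matrix V V α}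
    (hA : A.IsSymm) (x y : V → α) : x ⬝ᵥ A *ᵥ y = A *ᵥ x ⬝ᵥ y := by
  rw [dotProduct_mulVec, vecMul_eq_mulVec_of_isSymm hA]

theorem exists_mulVec_eq_of_orthogonal_ker {K : Type*} [Field K] {A : Matrix V V K}
    (hA : A.IsSymm) {b : V → K} (hb : ∀ x, A *ᵥ x = 0 → b ⬝ᵥ x = 0) : ∃ z, A *ᵥ z = b := by
  classical
  by_contra hrange
  have hnot : b ∉ LinearMap.range A.mulVecLin := fun ⟨z, hz⟩ => hrange ⟨z, hz⟩
  obtain ⟨f, hf, hle⟩ := Submodule.exists_le_ker_of_notMem hnot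
  obtain ⟨x, rfl⟩ := (dotProductEquiv K V).surjective f
  refine hf ?_
  rw [dotProductEquiv_apply_apply, dotProduct_comm]
  refine hb x (dotProduct_eq_zero _ fun y => ?_)
  rw [← dotProduct_mulVec_eq_mulVec_dotProduct hA]
  exact hle ⟨y, rfl⟩

end Nullity

section DeletedKernel

variable {V : Type*} [Fintype V] {A : Matrix V V ℝ} {r : V} {x w : V → ℝ}

/-- The kernel of `A(r)`, seen inside `ℝ^V` through extension by zero. -/
def deletedKernel (A : Matrix V V ℝ) (r : V) : Submodule ℝ (V → ℝ) where
  carrier := {x | x r = 0 ∧ ∀ v, v ≠ r → (A *ᵥ x) v = 0}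
  zero_mem' := by simp
  add_mem' := fun hx hy => ⟨by simp [hx.1, hy.1], fun v hv => by
    simp [mulVec_add, hx.2 v hv, hy.2 v hv]⟩
  smul_mem' := fun c x hx => ⟨by simp [hx.1], fun v hv => by simp [mulVec_smul, hx.2 v hv]⟩

theorem mem_deletedKernel_of_mulVec_eq_zero (hx : A *ᵥ x = 0) (hr : x r = 0) :
    x ∈ deletedKernel A r :=
  ⟨hr, fun v _ => congrFun hx v⟩

theorem sum_subtype_ne_of_eq_zero {α : Type*} [AddCommMonoid α] {f : V → α}
    [Fintype {v // v ≠ r}] (hr : f r = 0) : ∑ v : {v // v ≠ r}, f v = ∑ v, f v := by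
  classical
  rw [Fintype.sum_eq_add_sum_subtype_ne f r, hr, zero_add]
  convert rfl

theorem deleteIndex_mulVec [Fintype {v // v ≠ r}] (A : Matrix V V ℝ) (hr : x r = 0)
    (v : {v // v ≠ r}) : (deleteIndex A r *ᵥ fun u => x u) v = (A *ᵥ x) v :=
  sum_subtype_ne_of_eq_zero (f := fun u => A v u * x u) (by simp [hr])

theorem finrank_deletedKernel (A : Matrix V V ℝ) (r : V) [Fintype {v // v ≠ r}] :
    Module.finrank ℝ (deletedKernel A r) = nullity (deleteIndex A r) := by
  let restrict : deletedKernel A r →ₗ[ℝ] LinearMap.ker (deleteIndex A r).mulVecLin :=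
    (LinearMap.funLeft ℝ ℝ Subtype.val).restrict fun x hx => by
      ext v
      exact (deleteIndex_mulVec A hx.1 v).trans (hx.2 v v.2)
  refine (LinearEquiv.ofBijective restrict ⟨?_, ?_⟩).finrank_eq
  · rw [← LinearMap.ker_eq_bot, LinearMap.ker_eq_bot']
    rintro ⟨x, hx⟩ h
    ext v
    by_cases hv : v = r
    · exact hv ▸ hx.1
    · exact congrFun (congrArg Subtype.val h) ⟨v, hv⟩
  · rintro ⟨y, hy⟩
    have hr : Function.extend Subtype.val y 0 r = 0 :=
      Function.extend_apply' _ _ _ fun ⟨v, hv⟩ => v.2 hv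
    have hval : (fun u : {v // v ≠ r} => Function.extend Subtype.val y 0 u.1) = y :=
      funext fun u => Subtype.val_injective.extend_apply _ _ u
    refine ⟨⟨Function.extend Subtype.val y 0, hr, fun v hv => ?_⟩, Subtype.ext hval⟩
    rw [← deleteIndex_mulVec A hr ⟨v, hv⟩, hval]
    exact congrFun hy _

theorem dotProduct_mulVec_of_mem_deletedKernel (x : V → ℝ) (hw : w ∈ deletedKernel A r) :
    x ⬝ᵥ A *ᵥ w = x r * (A *ᵥ w) r :=
  Finset.sum_eq_single r (fun v _ hv => by rw [hw.2 v hv, mul_zero]) (by simp)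

theorem mulVec_eq_zero_of_mem_deletedKernel (hw : w ∈ deletedKernel A r) (hr : (A *ᵥ w) r = 0) :
    A *ᵥ w = 0 := by
  ext v
  by_cases hv : v = r
  · exact hv ▸ hr
  · exact hw.2 v hv

section IsSymm

variable (hA : A.IsSymm)
include hA

theorem apply_mul_mulVec_apply_eq_zero (hx : A *ᵥ x = 0) (hw : w ∈ deletedKernel A r) :
    x r * (A *ᵥ w) r = 0 := by
  rw [← dotProduct_mulVec_of_mem_deletedKernel x hw, dotProduct_mulVec_eq_mulVec_dotProduct hA, hx,
    zero_dotProduct]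

variable [Fintype {v // v ≠ r}]

theorem nullity_eq_nullity_deleteIndex_add_one (hx : A *ᵥ x = 0) (hxr : x r ≠ 0) :
    nullity A = nullity (deleteIndex A r) + 1 := by
  have hinf : LinearMap.ker A.mulVecLin ⊓ LinearMap.ker (LinearMap.proj r) =
      deletedKernel A r := by
    ext w
    refine ⟨fun hw => mem_deletedKernel_of_mulVec_eq_zero hw.1 hw.2, fun hw => ⟨?_, hw.1⟩⟩
    exact mulVec_eq_zero_of_mem_deletedKernel hw
      ((mul_eq_zero.1 (apply_mul_mulVec_apply_eq_zero hA hx hw)).resolve_left hxr)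
  rw [← finrank_deletedKernel, ← hinf, finrank_inf_ker_add_one (by exact hx) (by exact hxr)]
  rfl

theorem nullity_deleteIndex_eq_nullity_add_one (hw : w ∈ deletedKernel A r)
    (hwr : (A *ᵥ w) r ≠ 0) : nullity (deleteIndex A r) = nullity A + 1 := by
  have hinf : deletedKernel A r ⊓ LinearMap.ker (LinearMap.proj r ∘ₗ A.mulVecLin) =
      LinearMap.ker A.mulVecLin := by
    ext x
    refine ⟨fun hx => mulVec_eq_zero_of_mem_deletedKernel hx.1 hx.2,
      fun hx => ⟨mem_deletedKernel_of_mulVec_eq_zero hx ?_, congrFun hx r⟩⟩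
    exact (mul_eq_zero.1 (apply_mul_mulVec_apply_eq_zero hA hx hw)).resolve_right hwr
  rw [← finrank_deletedKernel, nullity, ← hinf, finrank_inf_ker_add_one hw (by exact hwr)]

omit hA in
theorem exists_mem_deletedKernel_of_nullity_lt (h : nullity A < nullity (deleteIndex A r)) :
    ∃ w ∈ deletedKernel A r, (A *ᵥ w) r ≠ 0 := by
  by_contra! hr
  rw [← finrank_deletedKernel] at h
  exact h.not_ge (Submodule.finrank_mono fun w hw =>
    mulVec_eq_zero_of_mem_deletedKernel hw (hr w hw))

theorem nullity_deleteIndex_le_nullity_add_one :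
    nullity (deleteIndex A r) ≤ nullity A + 1 := by
  by_contra! h
  obtain ⟨w, hw, hwr⟩ := exists_mem_deletedKernel_of_nullity_lt (Nat.lt_of_succ_lt h)
  exact h.ne' (nullity_deleteIndex_eq_nullity_add_one hA hw hwr)

theorem nullity_deleteIndex_eq_nullity_iff [DecidableEq V] :
    nullity (deleteIndex A r) = nullity A ↔ ∃ z, A *ᵥ z = Pi.single r 1 ∧ z r ≠ 0 := by
  refine ⟨fun h => ?_, fun ⟨z, hz, hzr⟩ => ?_⟩
  · obtain ⟨z, hz⟩ := exists_mulVec_eq_of_orthogonal_ker hA (b := Pi.single r 1) fun x hx => by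
      rw [single_one_dotProduct]
      by_contra hxr
      have := nullity_eq_nullity_deleteIndex_add_one hA hx hxr
      omega
    refine ⟨z, hz, fun hzr => ?_⟩
    have hmem : z ∈ deletedKernel A r := ⟨hzr, fun v hv => by rw [hz, Pi.single_eq_of_ne hv]⟩
    have := nullity_deleteIndex_eq_nullity_add_one hA hmem (by simp [hz])
    omega
  · have happly (y : V → ℝ) : y r = z ⬝ᵥ A *ᵥ y := by
      rw [dotProduct_mulVec_eq_mulVec_dotProduct hA, hz, single_one_dotProduct]
    have hker : deletedKernel A r = LinearMap.ker A.mulVecLin := by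
      ext y
      refine ⟨fun hy => mulVec_eq_zero_of_mem_deletedKernel hy ?_,
        fun hy => mem_deletedKernel_of_mulVec_eq_zero hy ?_⟩
      · rw [← mul_right_inj' hzr, ← dotProduct_mulVec_of_mem_deletedKernel z hy, ← happly, hy.1,
          mul_zero]
      · rw [happly y, show A *ᵥ y = 0 from hy, dotProduct_zero]
    rw [← finrank_deletedKernel, nullity, hker]

end IsSymm

end DeletedKernel

section StrongProperties

variable {V : Type*} {G : SimpleGraph V} {A X : Matrix V V ℝ} {r : V}

/-- The test matrices `X` of the strong properties: the real symmetric matrices with zero diagonal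
that vanish on the edges of `G`. -/
def complementSpace (G : SimpleGraph V) : Submodule ℝ (Matrix V V ℝ) where
  carrier := {X | X.IsSymm ∧ (∀ v, X v v = 0) ∧ ∀ v w, G.Adj v w → X v w = 0}
  zero_mem' := ⟨isSymm_zero, by simp, by simp⟩
  add_mem' := fun hX hY => ⟨hX.1.add hY.1, fun v => by simp [hX.2.1, hY.2.1],
    fun v w hvw => by simp [hX.2.2 v w hvw, hY.2.2 v w hvw]⟩
  smul_mem' := fun c X hX => ⟨hX.1.smul c, fun v => by simp [hX.2.1],
    fun v w hvw => by simp [hX.2.2 v w hvw]⟩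

/-- The strong Arnold property of `A` relative to the graph `G`. -/
def HasSAP [Fintype V] (G : SimpleGraph V) (A : Matrix V V ℝ) : Prop :=
  ∀ X ∈ complementSpace G, A * X = 0 → X = 0

theorem IsGraphMatrix.apply_eq_zero (hA : IsGraphMatrix G A) {v w : V} (hne : v ≠ w)
    (hvw : ¬ G.Adj v w) : A v w = 0 :=
  not_not.1 fun h => hvw ((hA.2 v w hne).1 h)

theorem IsGraphMatrix.mem_complementSpace_iff [DecidableEq V] (hA : IsGraphMatrix G A) :
    X ∈ complementSpace G ↔
      X.IsSymm ∧ hadamard A X = 0 ∧ hadamard (1 : Matrix V V ℝ) X = 0 := by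
  refine and_congr_right fun _ => ⟨fun ⟨hdiag, hadj⟩ => ⟨?_, ?_⟩, fun ⟨hAX, hIX⟩ => ⟨?_, ?_⟩⟩
  · ext v w
    obtain rfl | hvw := eq_or_ne v w
    · simp [hdiag]
    · by_cases h : G.Adj v w
      · simp [hadj v w h]
      · simp [hA.apply_eq_zero hvw h]
  · ext v w
    obtain rfl | hvw := eq_or_ne v w
    · simp [hdiag]
    · simp [one_apply, hvw]
  · intro v
    simpa using congrFun (congrFun hIX v) v
  · intro v w h
    simpa [(hA.2 v w h.ne).2 h] using congrFun (congrFun hAX v) w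

theorem IsGraphMatrix.deleteIndex (hA : IsGraphMatrix G A) (r : V) :
    IsGraphMatrix (G.comap (Subtype.val : {v // v ≠ r} → V)) (deleteIndex A r) :=
  ⟨hA.1.submatrix _, fun v w h => hA.2 v w (Subtype.val_injective.ne h)⟩

theorem deleteIndex_mem_complementSpace (hX : X ∈ complementSpace G) (r : V) :
    deleteIndex X r ∈ complementSpace (G.comap (Subtype.val : {v // v ≠ r} → V)) :=
  ⟨hX.1.submatrix _, fun v => hX.2.1 v, fun v w => hX.2.2 v w⟩

theorem exists_deleteIndex_eq {Y : Matrix {v // v ≠ r} {v // v ≠ r} ℝ}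
    (hY : Y ∈ complementSpace (G.comap (Subtype.val : {v // v ≠ r} → V))) :
    ∃ X ∈ complementSpace G, (∀ w, X r w = 0) ∧ deleteIndex X r = Y := by
  classical
  refine ⟨of fun v w => if h : v ≠ r ∧ w ≠ r then Y ⟨v, h.1⟩ ⟨w, h.2⟩ else 0,
    ⟨?_, fun v => ?_, fun v w hvw => ?_⟩, by simp, ?_⟩
  · ext v w
    by_cases hv : v = r <;> by_cases hw : w = r <;> simp [hv, hw, hY.1.apply ⟨v, _⟩]
  · by_cases hv : v = r <;> simp [hv, hY.2.1]
  · by_cases h : v ≠ r ∧ w ≠ r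
    · exact (dif_pos h).trans (hY.2.2 _ _ hvw)
    · exact dif_neg h
  · ext v w
    exact dif_pos ⟨v.2, w.2⟩

theorem eq_zero_of_deleteIndex_eq_zero (hX : X.IsSymm) (hr : ∀ w, X r w = 0)
    (h : deleteIndex X r = 0) : X = 0 := by
  ext v w
  by_cases hv : v = r
  · exact hv ▸ hr w
  by_cases hw : w = r
  · rw [← hX.apply, hw, hr, Matrix.zero_apply]
  · exact congrFun (congrFun h ⟨v, hv⟩) ⟨w, hw⟩

variable [Fintype V]

theorem deleteIndex_mul_deleteIndex [Fintype {v // v ≠ r}] (hr : ∀ w, X r w = 0) :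
    deleteIndex A r * deleteIndex X r = deleteIndex (A * X) r := by
  ext v w
  exact sum_subtype_ne_of_eq_zero (f := fun u => A v u * X u w) (by simp [hr])

theorem vecMul_eq_smul_row {x : V → ℝ} (h : ∀ v, v ≠ r → ∀ w, x v * X v w = 0) :
    x ᵥ* X = x r • X r :=
  funext fun w => Finset.sum_eq_single r (fun v _ hv => h v hv w) (by simp)

theorem hasSNIP_iff (hA : IsGraphMatrix G A) : HasSNIP A r ↔
    ∀ X ∈ complementSpace G, (∀ v, v ≠ r → ∀ w, (A * X) v w = 0) → X = 0 := by
  classical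
  have hrows (X : Matrix V V ℝ) :
      (A * X).submatrix (Subtype.val : {v // v ≠ r} → V) id = 0 ↔
        ∀ v, v ≠ r → ∀ w, (A * X) v w = 0 := by
    rw [← Matrix.ext_iff]
    exact Subtype.forall
  simp only [HasSNIP, hA.mem_complementSpace_iff, hrows, and_imp]

theorem HasSNIP.hasSAP (h : HasSNIP A r) (hA : IsGraphMatrix G A) : HasSAP G A :=
  fun X hX hAX => (hasSNIP_iff hA).1 h X hX (by simp [hAX])

theorem HasSNIP.hasSAP_deleteIndex [Fintype {v // v ≠ r}] (h : HasSNIP A r)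
    (hA : IsGraphMatrix G A) :
    HasSAP (G.comap (Subtype.val : {v // v ≠ r} → V)) (deleteIndex A r) := by
  intro Y hY hAY
  obtain ⟨X, hX, hr, rfl⟩ := exists_deleteIndex_eq hY
  rw [deleteIndex_mul_deleteIndex hr] at hAY
  have hX0 : X = 0 := (hasSNIP_iff hA).1 h X hX fun v hv w => by
    by_cases hw : w = r
    · rw [hw, mul_apply]
      exact Finset.sum_eq_zero fun u _ => by rw [← hX.1.apply, hr, mul_zero]
    · exact congrFun (congrFun hAY ⟨v, hv⟩) ⟨w, hw⟩
  rw [hX0]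
  rfl

theorem HasSAP.hasSNIP (h : HasSAP G A) (hA : IsGraphMatrix G A) {x : V → ℝ} (hx : A *ᵥ x = 0)
    (hr : x r ≠ 0) : HasSNIP A r := by
  refine (hasSNIP_iff hA).2 fun X hX hAX => h X hX ?_
  have hrow : x r • (A * X) r = 0 := by
    rw [← vecMul_eq_smul_row (fun v hv w => by rw [hAX v hv, mul_zero]), ← vecMul_vecMul,
      vecMul_eq_mulVec_of_isSymm hA.1, hx, zero_vecMul]
  ext v w
  by_cases hv : v = r
  · exact hv ▸ congrFun ((smul_eq_zero.1 hrow).resolve_left hr) w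
  · exact hAX v hv w

theorem HasSAP.hasSNIP_of_mem_deletedKernel [Fintype {v // v ≠ r}]
    (h : HasSAP (G.comap (Subtype.val : {v // v ≠ r} → V)) (deleteIndex A r))
    (hA : IsGraphMatrix G A) {w : V → ℝ} (hw : w ∈ deletedKernel A r) (hr : (A *ᵥ w) r ≠ 0) :
    HasSNIP A r := by
  refine (hasSNIP_iff hA).2 fun X hX hAX => ?_
  have hrow : (A *ᵥ w) r • X r = 0 := by
    rw [← vecMul_eq_smul_row (fun v hv u => by rw [hw.2 v hv, zero_mul]),
      ← vecMul_eq_mulVec_of_isSymm hA.1, vecMul_vecMul,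
      vecMul_eq_smul_row (r := r) (fun v hv u => by rw [hAX v hv, mul_zero]), hw.1, zero_smul]
  have hXr : ∀ u, X r u = 0 := congrFun ((smul_eq_zero.1 hrow).resolve_left hr)
  refine eq_zero_of_deleteIndex_eq_zero hX.1 hXr
    (h _ (deleteIndex_mem_complementSpace hX r) ?_)
  rw [deleteIndex_mul_deleteIndex hXr]
  ext v u
  exact hAX v v.2 u

section RootDiagonal

variable [DecidableEq V]

omit [Fintype V] in
theorem IsGraphMatrix.add_single (hA : IsGraphMatrix G A) (r : V) (c : ℝ) :
    IsGraphMatrix G (A + single r r c) := by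
  refine ⟨hA.1.add (transpose_single r r c), fun v w hvw => ?_⟩
  rw [Matrix.add_apply, single_apply_of_ne, add_zero, hA.2 v w hvw]
  grind

omit [Fintype V] in
theorem deleteIndex_add_single (A : Matrix V V ℝ) (r : V) (c : ℝ) :
    deleteIndex (A + single r r c) r = deleteIndex A r := by
  ext v w
  simp [deleteIndex, v.2.symm]

theorem HasSNIP.add_single (h : HasSNIP A r) (hA : IsGraphMatrix G A) (c : ℝ) :
    HasSNIP (A + single r r c) r := by
  refine (hasSNIP_iff (hA.add_single r c)).2 fun X hX hAX => (hasSNIP_iff hA).1 h X hX ?_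
  intro v hv w
  simpa [add_mul, single_mul_apply_of_ne, hv] using hAX v hv w

end RootDiagonal

end StrongProperties

theorem RootedGraph.allowsSNIP_self_iff {R : RootedGraph.{u}} {k : ℕ} :
    R.AllowsSNIP k k ↔ ∃ A, IsGraphMatrix R.graph A ∧ HasSAP R.graph A ∧ nullity A = k + 1 ∧
      ∃ x, A *ᵥ x = 0 ∧ x R.root ≠ 0 := by
  classical
  constructor
  · rintro ⟨A, hA, hk, hl, hS⟩
    obtain ⟨z, hz, hzr⟩ := (nullity_deleteIndex_eq_nullity_iff hA.1).1 (hl.trans hk.symm)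
    set B := A + single R.root R.root (-(z R.root)⁻¹)
    have hB : IsGraphMatrix R.graph B := hA.add_single _ _
    have hBz : B *ᵥ z = 0 := by
      ext v
      simp [B, add_mulVec, single_mulVec_eq, hz, hzr]
    refine ⟨B, hB, (hS.add_single hA _).hasSAP hB, ?_, z, hBz, hzr⟩
    rw [nullity_eq_nullity_deleteIndex_add_one hB.1 hBz hzr, deleteIndex_add_single, hl]
  · rintro ⟨A, hA, hS, hk, x, hx, hxr⟩
    have hB := hA.add_single R.root 1
    have hdel := nullity_eq_nullity_deleteIndex_add_one hA.1 hx hxr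
    have hBx : (A + single R.root R.root 1) *ᵥ ((x R.root)⁻¹ • x) = Pi.single R.root 1 := by
      simp [add_mulVec, mulVec_smul, single_mulVec_eq, hx, hxr]
    have heq := (nullity_deleteIndex_eq_nullity_iff hB.1).2 ⟨_, hBx, by simp [hxr]⟩
    rw [deleteIndex_add_single] at heq
    refine ⟨_, hB, ?_, ?_, (hS.hasSNIP hA hx hxr).add_single hA 1⟩
    · omega
    · rw [deleteIndex_add_single]
      omega

section Perturbation

variable {V : Type*} {G : SimpleGraph V} {A : Matrix V V ℝ} {r : V}

/-- The real symmetric matrices supported on the diagonal and on the edges of `G`: the tangent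
space of the set of matrices associated to `G`. -/
def patternSpace (G : SimpleGraph V) : Submodule ℝ (Matrix V V ℝ) where
  carrier := {E | E.IsSymm ∧ ∀ v w, v ≠ w → ¬ G.Adj v w → E v w = 0}
  zero_mem' := ⟨isSymm_zero, by simp⟩
  add_mem' := fun hE hF => ⟨hE.1.add hF.1, fun v w hne hvw => by
    simp [hE.2 v w hne hvw, hF.2 v w hne hvw]⟩
  smul_mem' := fun c E hE => ⟨hE.1.smul c, fun v w hne hvw => by simp [hE.2 v w hne hvw]⟩

theorem single_add_single_mem_patternSpace [DecidableEq V] {v w : V} (h : v = w ∨ G.Adj v w) :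
    single v w 1 + single w v 1 ∈ patternSpace G := by
  refine ⟨by simp [IsSymm, add_comm], fun a b hne hab => ?_⟩
  have hvw : ¬ (v = a ∧ w = b) := by grind
  have hwv : ¬ (w = a ∧ v = b) := by grind [G.adj_comm]
  rw [Matrix.add_apply, single_apply_of_ne _ _ _ _ _ hvw, single_apply_of_ne _ _ _ _ _ hwv,
    add_zero]

variable [Fintype V]

/-- The derivative at `Z = 1` of the congruence action `Z ↦ Zᵀ A Z`. -/
def congruenceDerivative (A : Matrix V V ℝ) : Matrix V V ℝ →ₗ[ℝ] Matrix V V ℝ :=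
  LinearMap.mulRight ℝ A ∘ₗ (transposeLinearEquiv V V ℝ ℝ).toLinearMap + LinearMap.mulLeft ℝ A

/-- Twice the projection of matrices onto the skew-symmetric ones. -/
def subTranspose (V : Type*) : Matrix V V ℝ →ₗ[ℝ] Matrix V V ℝ :=
  LinearMap.id - (transposeLinearEquiv V V ℝ ℝ).toLinearMap

theorem exists_dual_eq_trace_mul {α : Type*} [CommSemiring α]
    (f : Module.Dual α (Matrix V V α)) : ∃ S : Matrix V V α, ∀ M, f M = trace (S * M) := by
  classical
  refine ⟨of fun v w => f (single w v 1), fun M => ?_⟩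
  have h : f = traceLinearMap V α α ∘ₗ LinearMap.mulLeft α (of fun v w => f (single w v 1)) := by
    refine ext_linearMap _ fun v w => LinearMap.ext_ring ?_
    simp [trace_mul_single]
  exact LinearMap.congr_fun h M

theorem HasSAP.tangentSpaces_sup_eq_top (h : HasSAP G A) (hA : A.IsSymm) :
    LinearMap.range (congruenceDerivative A) ⊔
      (patternSpace G ⊔ LinearMap.range (subTranspose V)) = ⊤ := by
  classical
  by_contra hne
  obtain ⟨f, hf0, hf⟩ := Submodule.exists_le_ker_of_lt_top _ (lt_top_iff_ne_top.2 hne)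
  obtain ⟨S, hS⟩ := exists_dual_eq_trace_mul f
  obtain ⟨hcong, hpat, hskew⟩ : LinearMap.range (congruenceDerivative A) ≤ LinearMap.ker f ∧
      patternSpace G ≤ LinearMap.ker f ∧ LinearMap.range (subTranspose V) ≤ LinearMap.ker f := by
    simpa only [sup_le_iff] using hf
  have hsymm : S.IsSymm := by
    refine ext_iff_trace_mul_right.2 fun Y => ?_
    have hY : trace (S * (Y - Yᵀ)) = 0 := (hS _).symm.trans (hskew ⟨Y, rfl⟩)
    rw [mul_sub, trace_sub, sub_eq_zero] at hY
    rw [hY, ← trace_transpose, transpose_mul, transpose_transpose, trace_mul_comm]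
  have hzero : ∀ v w, v = w ∨ G.Adj v w → S v w = 0 := fun v w hvw => by
    have hE : trace (S * (single v w 1 + single w v 1)) = 0 :=
      (hS _).symm.trans (hpat (single_add_single_mem_patternSpace hvw))
    rw [mul_add, trace_add, trace_mul_single, trace_mul_single, hsymm.apply] at hE
    simpa using hE
  have hSA : S * A = 0 := by
    refine ext_iff_trace_mul_right.2 fun X => ?_
    have hX : trace (S * (Xᵀ * A + A * X)) = 0 := (hS _).symm.trans (hcong ⟨X, rfl⟩)
    have hflip : trace (S * (Xᵀ * A)) = trace (S * (A * X)) := by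
      rw [← trace_transpose, transpose_mul, transpose_mul, transpose_transpose, hsymm.eq, hA.eq,
        trace_mul_comm]
    rw [mul_add, trace_add, hflip, ← two_mul] at hX
    simpa [Matrix.mul_assoc] using hX
  have hS0 : S = 0 := h S ⟨hsymm, fun v => hzero v v (Or.inl rfl), fun v w hvw =>
    hzero v w (Or.inr hvw)⟩ (by
      rw [← transpose_eq_zero, transpose_mul, hsymm.eq, hA.eq, hSA])
  exact hf0 (LinearMap.ext fun M => by simp [hS, hS0])

open scoped Matrix.Norms.Operator Topology
open Filter

theorem HasSAP.eventually (h : HasSAP G A) : ∀ᶠ B in 𝓝 A, HasSAP G B := by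
  let mulOn (B : Matrix V V ℝ) : complementSpace G →L[ℝ] Matrix V V ℝ :=
    (ContinuousLinearMap.mul ℝ (Matrix V V ℝ) B).comp (complementSpace G).subtypeL
  have hiff (B : Matrix V V ℝ) : HasSAP G B ↔ Function.Injective (mulOn B) := by
    rw [injective_iff_map_eq_zero, Subtype.forall]
    simp only [HasSAP, Submodule.mk_eq_zero]
    rfl
  have hcont : Continuous mulOn :=
    (ContinuousLinearMap.mul ℝ (Matrix V V ℝ)).continuous.clm_comp continuous_const
  simp only [hiff] at h ⊢
  exact (ContinuousLinearMap.isOpen_injective.preimage hcont).mem_nhds h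

omit [Fintype V] in
theorem IsGraphMatrix.eventually_add [Finite V] (hA : IsGraphMatrix G A) :
    ∀ᶠ E in 𝓝 (0 : Matrix V V ℝ), E ∈ patternSpace G → IsGraphMatrix G (A + E) := by
  have hedge (v w : V) : ∀ᶠ E in 𝓝 (0 : Matrix V V ℝ), G.Adj v w → (A + E) v w ≠ 0 := by
    rw [eventually_imp_distrib_left]
    intro hvw
    refine ContinuousAt.eventually_ne (g := fun E : Matrix V V ℝ => (A + E) v w) ?_ ?_
    · exact ((continuous_const.add continuous_id).matrix_elem v w).continuousAt
    · simpa using (hA.2 v w hvw.ne).2 hvw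
  filter_upwards [eventually_all.2 fun v => eventually_all.2 (hedge v)] with E hE hEG
  refine ⟨hA.1.add hEG.1, fun v w hne => ⟨fun h => ?_, hE v w⟩⟩
  by_contra hvw
  exact h (by rw [Matrix.add_apply, hA.apply_eq_zero hne hvw, hEG.2 v w hne hvw, add_zero])

theorem hasStrictFDerivAt_congruence [DecidableEq V] (A : Matrix V V ℝ) :
    HasStrictFDerivAt (fun Z : Matrix V V ℝ => Zᵀ * A * Z)
      (congruenceDerivative A).toContinuousLinearMap 1 := by
  have htr : HasStrictFDerivAt (transpose : Matrix V V ℝ → Matrix V V ℝ)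
      (transposeLinearEquiv V V ℝ ℝ).toLinearMap.toContinuousLinearMap 1 :=
    (transposeLinearEquiv V V ℝ ℝ).toLinearMap.toContinuousLinearMap.hasStrictFDerivAt
  refine ((htr.mul_const' A).mul' (hasStrictFDerivAt_id 1)).congr_fderiv ?_
  refine ContinuousLinearMap.ext fun X => ?_
  change 1ᵀ * A * X + Xᵀ * A * 1 = Xᵀ * A + A * X
  rw [transpose_one, Matrix.one_mul, Matrix.mul_one, add_comm]

theorem HasSAP.map_nhds_congruence_add [DecidableEq V] (h : HasSAP G A) (hA : A.IsSymm) :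
    map (fun p : Matrix V V ℝ × patternSpace G × Matrix V V ℝ =>
      p.1ᵀ * A * p.1 + (p.2.1 + (p.2.2 - p.2.2ᵀ))) (𝓝 (1, 0)) = 𝓝 A := by
  let ℓ : patternSpace G × Matrix V V ℝ →L[ℝ] Matrix V V ℝ :=
    ((patternSpace G).subtype.coprod (subTranspose V)).toContinuousLinearMap
  have hderiv : HasStrictFDerivAt
      (fun p : Matrix V V ℝ × patternSpace G × Matrix V V ℝ => p.1ᵀ * A * p.1 + ℓ p.2)
      ((congruenceDerivative A).toContinuousLinearMap.coprod ℓ) (1, 0) :=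
    (((hasStrictFDerivAt_congruence A).comp
      ((1, 0) : Matrix V V ℝ × patternSpace G × Matrix V V ℝ) hasStrictFDerivAt_fst).add
      (ℓ.hasStrictFDerivAt.comp _ hasStrictFDerivAt_snd)).congr_fderiv
        (ContinuousLinearMap.ext fun _ => rfl)
  have hsurj : ((congruenceDerivative A).toContinuousLinearMap.coprod ℓ).range = ⊤ := by
    have h := h.tangentSpaces_sup_eq_top hA
    rwa [← (patternSpace G).range_subtype, ← LinearMap.range_coprod, ← LinearMap.range_coprod] at h
  have : CompleteSpace (patternSpace G) :=
    completeSpace_coe_iff_isComplete.2 (patternSpace G).complete_of_finiteDimensional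
  have hmap := hderiv.map_nhds_eq_of_surj hsurj
  simp only [transpose_one, Matrix.one_mul, Matrix.mul_one, map_zero, add_zero] at hmap
  exact hmap

omit [Fintype V] in
theorem sub_transpose_eq_zero_of_isSymm {Y : Matrix V V ℝ} (hY : (Y - Yᵀ).IsSymm) :
    Y - Yᵀ = 0 := by
  have hneg : (Y - Yᵀ)ᵀ = -(Y - Yᵀ) := by rw [transpose_sub, transpose_transpose, neg_sub]
  rw [hY.eq] at hneg
  ext v w
  exact self_eq_neg.1 (congrFun (congrFun hneg v) w)

theorem HasSAP.eventually_exists_congruence [DecidableEq V] (h : HasSAP G A) (hA : A.IsSymm)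
    {s t : Set (Matrix V V ℝ)} (hs : s ∈ 𝓝 1) (ht : t ∈ 𝓝 0) :
    ∀ᶠ F in 𝓝 (0 : Matrix V V ℝ), F.IsSymm →
      ∃ Z ∈ s, ∃ E ∈ t, E ∈ patternSpace G ∧ A + E + F = Zᵀ * A * Z := by
  have hnhds : {p : Matrix V V ℝ × patternSpace G × Matrix V V ℝ |
      p.1 ∈ s ∧ -(p.2.1 : Matrix V V ℝ) ∈ t} ∈ 𝓝 (1, 0) := by
    have hcont : Continuous fun p : Matrix V V ℝ × patternSpace G × Matrix V V ℝ =>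
        -(p.2.1 : Matrix V V ℝ) := by fun_prop
    exact inter_mem (continuous_fst.continuousAt hs) (hcont.continuousAt (by simpa using ht))
  have himage := h.map_nhds_congruence_add hA ▸ image_mem_map hnhds
  have hadd : Tendsto (fun F => A + F) (𝓝 0) (𝓝 A) :=
    (continuous_const_add A).tendsto' 0 A (add_zero A)
  filter_upwards [hadd himage] with F ⟨⟨Z, E, Y⟩, ⟨hZ, hE⟩, hF⟩ hFsymm
  dsimp only at hZ hE hF
  have hsymm : (Y - Yᵀ).IsSymm := by
    have hY : Y - Yᵀ = A + F - Zᵀ * A * Z - E := by rw [← hF]; abel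
    rw [hY]
    refine ((hA.add hFsymm).sub ?_).sub E.2.1
    rw [IsSymm, transpose_mul, transpose_mul, transpose_transpose, hA.eq, Matrix.mul_assoc]
  refine ⟨Z, hZ, -E, hE, neg_mem E.2, ?_⟩
  rw [sub_transpose_eq_zero_of_isSymm hsymm, add_zero] at hF
  rw [add_right_comm, ← hF, add_neg_cancel_right]

section RootCross

variable [DecidableEq V]

/-- The symmetric matrix `e_r uᵀ + u e_rᵀ`, supported on the row and the column of `r`. -/
def crossMatrix (r : V) (u : V → ℝ) : Matrix V V ℝ :=
  vecMulVec (Pi.single r 1) u + vecMulVec u (Pi.single r 1)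

omit [Fintype V] in
theorem isSymm_crossMatrix (r : V) (u : V → ℝ) : (crossMatrix r u).IsSymm := by
  rw [IsSymm, crossMatrix, transpose_add, transpose_vecMulVec, transpose_vecMulVec, add_comm]

omit [Fintype V] in
theorem deleteIndex_add_smul_crossMatrix (B : Matrix V V ℝ) (r : V) (u : V → ℝ) (c : ℝ) :
    deleteIndex (B + c • crossMatrix r u) r = deleteIndex B r := by
  ext v w
  simp [deleteIndex, crossMatrix, vecMulVec_apply, v.2, w.2]

theorem crossMatrix_mulVec {z : V → ℝ} (hz : z r = 0) (u : V → ℝ) :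
    crossMatrix r u *ᵥ z = Pi.single r (u ⬝ᵥ z) := by
  ext v
  simp [crossMatrix, add_mulVec, vecMulVec_mulVec, hz, Pi.single_apply]

end RootCross

/-- The combination of `x` and `u` that vanishes at `r`. -/
def cancelAt (r : V) (x u : V → ℝ) : V → ℝ := x r • u - u r • x

theorem eventually_dotProduct_cancelAt_inv_ne_zero [DecidableEq V] {x u : V → ℝ} (hxr : x r ≠ 0)
    (hur : u r = 0) (hu : u ≠ 0) :
    ∀ᶠ Z in 𝓝 (1 : Matrix V V ℝ),
      IsUnit Z ∧ (Z⁻¹ *ᵥ x) r ≠ 0 ∧ u ⬝ᵥ cancelAt r (Z⁻¹ *ᵥ x) (Z⁻¹ *ᵥ u) ≠ 0 := by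
  have hunit : ∀ᶠ Z in 𝓝 (1 : Matrix V V ℝ), IsUnit Z := Units.nhds 1
  have hinv : ContinuousAt (Inv.inv : Matrix V V ℝ → Matrix V V ℝ) 1 :=
    continuousAt_matrix_inv 1 (by simp)
  have hmul (y : V → ℝ) : ContinuousAt (fun Z : Matrix V V ℝ => Z⁻¹ *ᵥ y) 1 :=
    (continuous_id.matrix_mulVec continuous_const).continuousAt.comp hinv
  have hroot (y : V → ℝ) : ContinuousAt (fun Z : Matrix V V ℝ => (Z⁻¹ *ᵥ y) r) 1 :=
    (continuous_apply r).continuousAt.comp (hmul y)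
  have hcancel : ContinuousAt
      (fun Z : Matrix V V ℝ => u ⬝ᵥ cancelAt r (Z⁻¹ *ᵥ x) (Z⁻¹ *ᵥ u)) 1 :=
    (continuous_const.dotProduct continuous_id).continuousAt.comp
      (((hroot x).smul (hmul u)).sub ((hroot u).smul (hmul x)))
  refine hunit.and (((hroot x).eventually_ne ?_).and (hcancel.eventually_ne ?_))
  · simpa using hxr
  · simp [cancelAt, hur, hxr, hu, dotProduct_self_eq_zero]

theorem mulVec_inv_mulVec_eq_zero_of_congruence {α : Type*} [CommRing α] [DecidableEq V]
    {A Z : Matrix V V α} (hZ : IsUnit Z) {x : V → α} (hx : A *ᵥ x = 0) :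
    (Zᵀ * A * Z) *ᵥ (Z⁻¹ *ᵥ x) = 0 := by
  rw [mulVec_mulVec, mul_nonsing_inv_cancel_right _ _ ((isUnit_iff_isUnit_det Z).1 hZ),
    ← mulVec_mulVec, hx, mulVec_zero]

theorem HasSAP.exists_perturbation [Fintype {v // v ≠ r}] (h : HasSAP G A) (hA : A.IsSymm)
    {x u : V → ℝ} (hx : A *ᵥ x = 0) (hxr : x r ≠ 0) (hu : A *ᵥ u = 0) (hur : u r = 0)
    (hu0 : u ≠ 0) {t : Set (Matrix V V ℝ)} (ht : t ∈ 𝓝 0) :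
    ∃ E ∈ t, E ∈ patternSpace G ∧ nullity A = nullity (deleteIndex (A + E) r) + 1 ∧
      ∃ z ∈ deletedKernel (A + E) r, ((A + E) *ᵥ z) r ≠ 0 := by
  -- Congruence preserves the nullity of `B = A + E + c (e_r uᵀ + u e_rᵀ)`, and deleting `r` erases
  -- the last summand. The vector `z` of `ker B` that vanishes at `r` lies in the deleted kernel of
  -- `A + E`, but `A + E` maps it to a nonzero multiple of `e_r`.
  classical
  have hsmall : Tendsto (fun c : ℝ => c • crossMatrix r u) (𝓝[≠] 0) (𝓝 0) :=
    ((continuous_id.smul continuous_const).tendsto' 0 0 (zero_smul ℝ _)).mono_left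
      nhdsWithin_le_nhds
  obtain ⟨c, hc, hc0⟩ := ((hsmall.eventually (h.eventually_exists_congruence hA
    (eventually_dotProduct_cancelAt_inv_ne_zero hxr hur hu0) ht)).and
      self_mem_nhdsWithin).exists
  obtain ⟨Z, ⟨hZ, hZx, hZu⟩, E, hEt, hE, hB⟩ := hc ((isSymm_crossMatrix r u).smul c)
  set B := A + E + c • crossMatrix r u
  have hBx : B *ᵥ (Z⁻¹ *ᵥ x) = 0 := hB ▸ mulVec_inv_mulVec_eq_zero_of_congruence hZ hx
  have hBu : B *ᵥ (Z⁻¹ *ᵥ u) = 0 := hB ▸ mulVec_inv_mulVec_eq_zero_of_congruence hZ hu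
  have hBsymm : B.IsSymm := (hA.add hE.1).add ((isSymm_crossMatrix r u).smul c)
  have hnull := nullity_eq_nullity_deleteIndex_add_one hBsymm hBx hZx
  rw [deleteIndex_add_smul_crossMatrix, hB, nullity_transpose_mul_mul hZ] at hnull
  set z := cancelAt r (Z⁻¹ *ᵥ x) (Z⁻¹ *ᵥ u)
  have hzr : z r = 0 := by simp [z, cancelAt, mul_comm]
  have hBz : B *ᵥ z = 0 := by simp [z, cancelAt, mulVec_sub, mulVec_smul, hBx, hBu]
  have hAEz : (A + E) *ᵥ z = -c • Pi.single r (u ⬝ᵥ z) := by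
    rw [add_mulVec, smul_mulVec, crossMatrix_mulVec hzr] at hBz
    rw [neg_smul]
    exact eq_neg_of_add_eq_zero_left hBz
  refine ⟨E, hEt, hE, hnull, z, ⟨hzr, fun v hv => ?_⟩, ?_⟩
  · simp [hAEz, hv]
  · simpa [hAEz] using ⟨hc0, hZu⟩

theorem RootedGraph.AllowsSNIP.pred_left {R : RootedGraph.{u}} {k : ℕ}
    (h : R.AllowsSNIP (k + 1) (k + 1)) : R.AllowsSNIP k (k + 1) := by
  classical
  obtain ⟨A, hA, hS, hk, x, hx, hxr⟩ := allowsSNIP_self_iff.1 h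
  obtain ⟨u, hu, hu0⟩ : ∃ u ∈ LinearMap.ker A.mulVecLin ⊓ LinearMap.ker (LinearMap.proj R.root),
      u ≠ 0 := by
    refine Submodule.exists_mem_ne_zero_of_ne_bot fun hbot => ?_
    have hdim := finrank_inf_ker_add_one (U := LinearMap.ker A.mulVecLin)
      (φ := LinearMap.proj R.root) hx hxr
    rw [hbot, finrank_bot] at hdim
    have : nullity A = 1 := hdim.symm
    omega
  have hdelete : Tendsto (fun E => deleteIndex (A + E) R.root) (𝓝 0) (𝓝 (deleteIndex A R.root)) :=
    ((continuous_const_add A).matrix_submatrix _ _).tendsto' _ _ (by simp [deleteIndex])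
  have hSAP := hdelete.eventually ((hS.hasSNIP hA hx hxr).hasSAP_deleteIndex hA).eventually
  obtain ⟨E, ⟨hAE, hSE⟩, hE, hnull, z, hz, hzr⟩ := hS.exists_perturbation hA.1 hx hxr hu.1 hu.2 hu0
    (hA.eventually_add.and hSAP)
  have hdel := nullity_deleteIndex_eq_nullity_add_one (hA.1.add hE.1) hz hzr
  exact ⟨A + E, hAE hE, by omega, by omega, hSE.hasSNIP_of_mem_deletedKernel (hAE hE) hz hzr⟩

end Perturbation

section Transport

variable {V W : Type*} {G : SimpleGraph V} {H : SimpleGraph W} {A : Matrix V V ℝ}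

theorem IsGraphMatrix.submatrix (hA : IsGraphMatrix G A) (e : H ≃g G) :
    IsGraphMatrix H (A.submatrix e e) :=
  ⟨hA.1.submatrix e, fun _ _ hvw => (hA.2 _ _ (e.injective.ne hvw)).trans e.map_adj_iff⟩

theorem nullity_deleteIndex_submatrix (A : Matrix V V ℝ) (e : W ≃ V) (r : W)
    [Fintype {w // w ≠ r}] [Fintype {v // v ≠ e r}] :
    nullity (deleteIndex (A.submatrix e e) r) = nullity (deleteIndex A (e r)) :=
  nullity_submatrix (deleteIndex A (e r))
    (e.subtypeEquiv fun w => (e.injective.ne_iff (x := w) (y := r)).symm)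

theorem HasSNIP.submatrix [Fintype V] [Fintype W] (e : W ≃ V) {r : W} (h : HasSNIP A (e r)) :
    HasSNIP (A.submatrix e e) r := by
  classical
  intro X hX hAX hIX hrows
  have hmul : A * X.submatrix e.symm e.symm = (A.submatrix e e * X).submatrix e.symm e.symm := by
    rw [submatrix_mul _ _ _ e.symm _ e.symm.bijective, submatrix_submatrix]
    simp
  have hzero : X.submatrix e.symm e.symm = 0 := by
    refine h _ (hX.submatrix e.symm) ?_ ?_ ?_
    · ext v w
      simpa using congrFun (congrFun hAX (e.symm v)) (e.symm w)
    · ext v w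
      simpa [one_apply] using congrFun (congrFun hIX (e.symm v)) (e.symm w)
    · ext v w
      rw [hmul]
      exact congrFun (congrFun hrows ⟨e.symm v, fun hv => v.2 (e.symm_apply_eq.1 hv)⟩) (e.symm w)
  ext v w
  simpa using congrFun (congrFun hzero (e v)) (e w)

end Transport

section BorderedMatrix

variable {V : Type*} [DecidableEq V] {G : SimpleGraph V} {r : V}

/-- The symmetric bordering of `B` by a row and a column `b` at `r`, with zero as the diagonal
entry at `r`. -/
def borderedMatrix (B : Matrix {v // v ≠ r} {v // v ≠ r} ℝ) (b : {v // v ≠ r} → ℝ) :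
    Matrix V V ℝ :=
  of fun v w =>
    if hv : v = r then if hw : w = r then 0 else b ⟨w, hw⟩
    else if hw : w = r then b ⟨v, hv⟩ else B ⟨v, hv⟩ ⟨w, hw⟩

theorem deleteIndex_borderedMatrix (B : Matrix {v // v ≠ r} {v // v ≠ r} ℝ)
    (b : {v // v ≠ r} → ℝ) : deleteIndex (borderedMatrix B b) r = B := by
  ext v w
  simp [deleteIndex, borderedMatrix, v.2, w.2]

theorem isGraphMatrix_borderedMatrix {B : Matrix {v // v ≠ r} {v // v ≠ r} ℝ}
    (hB : IsGraphMatrix (G.comap Subtype.val) B) {b : {v // v ≠ r} → ℝ}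
    (hb : ∀ v, b v ≠ 0 ↔ G.Adj r v) : IsGraphMatrix G (borderedMatrix B b) := by
  constructor
  · ext v w
    by_cases hv : v = r <;> by_cases hw : w = r <;>
      simp [borderedMatrix, hv, hw, hB.1.apply ⟨v, _⟩]
  · intro v w hvw
    by_cases hv : v = r
    · have hw : w ≠ r := hv ▸ hvw.symm
      simpa [borderedMatrix, hv, hw] using hb ⟨w, hw⟩
    by_cases hw : w = r
    · simpa [borderedMatrix, hv, hw, G.adj_comm] using hb ⟨v, hv⟩
    · simpa [borderedMatrix, hv, hw] using hB.2 ⟨v, hv⟩ ⟨w, hw⟩ (by simpa using hvw)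

theorem borderedMatrix_mulVec_apply_root [Fintype V] (B : Matrix {v // v ≠ r} {v // v ≠ r} ℝ)
    (b : {v // v ≠ r} → ℝ) {z : V → ℝ} (hz : z r = 0) :
    (borderedMatrix B b *ᵥ z) r = b ⬝ᵥ fun v => z v := by
  refine (sum_subtype_ne_of_eq_zero (r := r) ?_).symm.trans (Finset.sum_congr rfl fun v _ => ?_)
  · simp [hz]
  · simp [borderedMatrix, v.2]

end BorderedMatrix

theorem exists_support_eq_dotProduct_ne_zero {ι α : Type*} [Fintype ι] [Ring α] [LinearOrder α]
    [IsStrictOrderedRing α] {N : Set ι} {x : ι → α} {j : ι} (hj : j ∈ N) (hx : x j ≠ 0) :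
    ∃ b : ι → α, (∀ i, b i ≠ 0 ↔ i ∈ N) ∧ b ⬝ᵥ x ≠ 0 := by
  classical
  refine ⟨fun i => if i ∈ N then if x i = 0 then 1 else x i else 0, fun i => ?_, ?_⟩
  · grind
  · refine (Finset.sum_pos' (fun i _ => ?_) ⟨j, Finset.mem_univ j, ?_⟩).ne'
    · beta_reduce
      split_ifs with hi hxi
      · simp [hxi]
      · exact mul_self_nonneg (x i)
      · simp
    · simp [hj, hx]

namespace RootedGraph

variable {R S : RootedGraph.{u}} {k l : ℕ}

theorem AllowsSNIP.of_isIso (hS : S.AllowsSNIP k l) (h : R.IsIso S) : R.AllowsSNIP k l := by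
  classical
  obtain ⟨e, he⟩ := h
  obtain ⟨A, hA, hk, hl, hSNIP⟩ := hS
  rw [← he] at hl hSNIP
  exact ⟨A.submatrix e e, hA.submatrix e, (nullity_submatrix A e.toEquiv).trans hk,
    (nullity_deleteIndex_submatrix A e.toEquiv R.root).trans hl, hSNIP.submatrix e.toEquiv⟩

open Classical in
/-- The rooted graph obtained by deleting the root and rooting what is left at `j`. -/
noncomputable def deleteRoot (R : RootedGraph.{u}) (j : {v // v ≠ R.root}) : RootedGraph.{u} where
  V := {v // v ≠ R.root}
  graph := R.graph.comap Subtype.val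
  root := j

theorem AllowsSNIP.exists_deleteRoot (h : R.AllowsSNIP k (k + 1)) :
    ∃ j : {v // v ≠ R.root}, R.graph.Adj R.root j ∧ (R.deleteRoot j).AllowsSNIP k k := by
  classical
  obtain ⟨A, hA, hk, hl, hS⟩ := h
  obtain ⟨w, hw, hwr⟩ := exists_mem_deletedKernel_of_nullity_lt
    (hk.trans_lt (Nat.lt_succ_self k) |>.trans_eq hl.symm)
  obtain ⟨j, -, hj⟩ := Finset.exists_ne_zero_of_sum_ne_zero hwr
  have hjr : j ≠ R.root := by
    rintro rfl
    exact hj (mul_eq_zero_of_right _ hw.1)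
  refine ⟨⟨j, hjr⟩, (hA.2 _ _ hjr.symm).1 (left_ne_zero_of_mul hj), allowsSNIP_self_iff.2
    ⟨deleteIndex A R.root, hA.deleteIndex R.root, hS.hasSAP_deleteIndex hA, hl,
      fun v : {v // v ≠ R.root} => w v, ?_,
      right_ne_zero_of_mul hj⟩⟩
  exact funext fun v : {v // v ≠ R.root} => (deleteIndex_mulVec A hw.1 v).trans (hw.2 v v.2)

theorem AllowsSNIP.of_deleteRoot {j : {v // v ≠ R.root}} (hj : R.graph.Adj R.root j)
    (h : (R.deleteRoot j).AllowsSNIP k k) : R.AllowsSNIP k (k + 1) := by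
  classical
  obtain ⟨B, hB, hS, hk, x, hx, hxj⟩ := allowsSNIP_self_iff.1 h
  obtain ⟨b, hb, hbx⟩ := exists_support_eq_dotProduct_ne_zero
    (N := {v : {v // v ≠ R.root} | R.graph.Adj R.root v}) hj hxj
  have hA := isGraphMatrix_borderedMatrix hB hb
  have hdel := deleteIndex_borderedMatrix B b
  set A := borderedMatrix B b
  obtain ⟨z, hzr, hz⟩ : ∃ z : R.V → ℝ, z R.root = 0 ∧ (fun v : {v // v ≠ R.root} => z v) = x :=
    ⟨fun v => if hv : v = R.root then 0 else x ⟨v, hv⟩, by simp, by ext v; simp [v.2]⟩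
  have hzA : z ∈ deletedKernel A R.root := by
    refine ⟨hzr, fun v hv => ?_⟩
    rw [← deleteIndex_mulVec A hzr ⟨v, hv⟩, hz, hdel]
    exact congrFun hx _
  have hzroot : (A *ᵥ z) R.root ≠ 0 := by
    rwa [borderedMatrix_mulVec_apply_root B b hzr, hz]
  have hnull := nullity_deleteIndex_eq_nullity_add_one hA.1 hzA hzroot
  rw [hdel] at hnull
  refine ⟨A, hA, ?_, ?_, ?_⟩
  · exact Nat.succ_injective (hnull.symm.trans hk)
  · rw [hdel]
    exact hk
  · refine HasSAP.hasSNIP_of_mem_deletedKernel ?_ hA hzA hzroot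
    rwa [hdel]

end RootedGraph

namespace RootedGraph

section Isomorphisms

variable {R S T : RootedGraph.{u}}

theorem IsIso.refl (R : RootedGraph.{u}) : R.IsIso R := ⟨.refl, rfl⟩

theorem IsIso.symm : R.IsIso S → S.IsIso R := fun ⟨e, he⟩ => ⟨e.symm, by simp [← he]⟩

theorem IsIso.trans : R.IsIso S → S.IsIso T → R.IsIso T :=
  fun ⟨e, he⟩ ⟨e', he'⟩ => ⟨e.trans e', by simp [he, he']⟩

theorem isIso_of_bijective {f : R.V → S.V} (hf : f.Bijective)
    (hadj : ∀ p q, S.graph.Adj (f p) (f q) ↔ R.graph.Adj p q) (hroot : f R.root = S.root) :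
    R.IsIso S :=
  ⟨⟨Equiv.ofBijective f hf, fun {p q} => hadj p q⟩, hroot⟩

end Isomorphisms

section Quotients

variable {R S T : RootedGraph.{u}} {f : R.V → S.V}

/-- `f` presents `S` as a quotient of `R`: the vertices and edges of `S` are the images of those
of `R`, up to loops and parallel edges, and so is its root. -/
structure IsQuotientMap (f : R.V → S.V) : Prop where
  surjective : f.Surjective
  adj_iff : ∀ x y, S.graph.Adj x y ↔ x ≠ y ∧ ∃ p q, f p = x ∧ f q = y ∧ R.graph.Adj p q
  map_root : f R.root = S.root

theorem IsQuotientMap.isIso {g : R.V → T.V} (hf : IsQuotientMap f) (hg : IsQuotientMap g)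
    (h : ∀ p q, f p = f q ↔ g p = g q) : S.IsIso T := by
  obtain ⟨e, he⟩ : ∃ e : S.V → T.V, ∀ p, e (f p) = g p :=
    ⟨g ∘ Function.surjInv hf.surjective, fun p => (h _ _).1 (Function.surjInv_eq _ _)⟩
  refine isIso_of_bijective (f := e) ⟨?_, fun t => ?_⟩ ?_ ?_
  · refine hf.surjective.forall₂.2 fun p q hpq => (h p q).2 ?_
    rwa [he, he] at hpq
  · obtain ⟨p, rfl⟩ := hg.surjective t
    exact ⟨f p, he p⟩
  · refine hf.surjective.forall₂.2 fun p q => ?_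
    rw [he, he, hf.adj_iff, hg.adj_iff]
    simp only [ne_eq, h]
  · rw [← hf.map_root, he, hg.map_root]

theorem isQuotientMap_iso {e : R.graph ≃g S.graph} (he : e R.root = S.root) :
    IsQuotientMap (R := R) (S := S) e where
  surjective := e.surjective
  adj_iff := e.surjective.forall₂.2 fun p q => by
    rw [e.map_adj_iff]
    simpa using SimpleGraph.Adj.ne
  map_root := he

theorem IsQuotientMap.comp {g : S.V → T.V} (hg : IsQuotientMap g) (hf : IsQuotientMap f) :
    IsQuotientMap (g ∘ f) where
  surjective := hg.surjective.comp hf.surjective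
  adj_iff x y := by
    rw [hg.adj_iff]
    simp only [hf.adj_iff]
    grind
  map_root := by simp [hf.map_root, hg.map_root]

end Quotients

section Operations

/-- The rooted graph obtained by removing the edge `e`. -/
def deleteEdge (R : RootedGraph.{u}) (e : Sym2 R.V) : RootedGraph.{u} :=
  { R with graph := R.graph.deleteEdges {e} }

open Classical in
/-- The rooted graph obtained by removing the vertex `v`, which is not the root. -/
noncomputable def deleteVertex (R : RootedGraph.{u}) (v : R.V) (hv : v ≠ R.root) :
    RootedGraph.{u} where
  V := {w // w ≠ v}
  graph := R.graph.comap Subtype.val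
  root := ⟨R.root, hv.symm⟩

/-- The equivalence relation identifying exactly the two endpoints of `e`. -/
def pairSetoid {V : Type*} (e : Sym2 V) : Setoid V where
  r x y := x = y ∨ s(x, y) = e
  iseqv := by
    induction e with
    | _ a b => constructor <;> grind

open Classical in
/-- The rooted graph obtained by contracting `e`, whether or not `e` is an edge. -/
noncomputable def contract (R : RootedGraph.{u}) (e : Sym2 R.V) : RootedGraph.{u} where
  V := Quotient (pairSetoid e)
  graph := R.graph.map (Quotient.mk (pairSetoid e))
  root := Quotient.mk (pairSetoid e) R.root

variable {R S T F : RootedGraph.{u}}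

/-- The map sending a vertex to its image under the contraction of `e`. -/
def contractMap (R : RootedGraph.{u}) (e : Sym2 R.V) : R.V → (R.contract e).V :=
  Quotient.mk (pairSetoid e)

theorem contractMap_eq_contractMap_iff {e : Sym2 R.V} {x y : R.V} :
    R.contractMap e x = R.contractMap e y ↔ x = y ∨ s(x, y) = e :=
  Quotient.eq

theorem isQuotientMap_contractMap (R : RootedGraph.{u}) (e : Sym2 R.V) :
    IsQuotientMap (R.contractMap e) where
  surjective := Quotient.mk_surjective
  adj_iff _ _ := (SimpleGraph.map_adj' ..).trans
    (and_congr_right fun _ => exists₂_congr fun _ _ => and_comm.trans and_assoc)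
  map_root := rfl

theorem IsQuotientMap.isIso_contract {f : R.V → S.V} (hf : IsQuotientMap f) {e : Sym2 R.V}
    (h : ∀ x y, f x = f y ↔ x = y ∨ s(x, y) = e) : S.IsIso (R.contract e) :=
  hf.isIso (isQuotientMap_contractMap R e) fun x y =>
    (h x y).trans contractMap_eq_contractMap_iff.symm

theorem step_iff : Step R S ↔ (∃ e ∈ R.graph.edgeSet, S.IsIso (R.deleteEdge e)) ∨
    (∃ v, ∃ hv : v ≠ R.root, S.IsIso (R.deleteVertex v hv)) ∨
      ∃ e ∈ R.graph.edgeSet, S.IsIso (R.contract e) := by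
  constructor
  · rintro (⟨a, b, hab, e, he⟩ | ⟨v, hv, e, he⟩ | ⟨a, b, hab, f, hf, hfib, hadj, hroot⟩)
    · exact .inl ⟨s(a, b), hab, e, he⟩
    · exact .inr (.inl ⟨v, hv, e, Subtype.ext he⟩)
    · refine .inr (.inr ⟨s(a, b), hab, IsQuotientMap.isIso_contract ⟨hf, hadj, hroot⟩ ?_⟩)
      simpa using hfib
  · rintro (⟨e, hab, φ, hφ⟩ | ⟨v, hv, φ, hφ⟩ | ⟨e, hab, hS⟩)
    · induction e with
      | _ a b => exact .deleteEdge a b hab φ hφ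
    · exact .deleteVertex v hv φ (congrArg Subtype.val hφ)
    · obtain ⟨φ, hφ⟩ := hS.symm
      have hq := (isQuotientMap_iso hφ).comp (isQuotientMap_contractMap R e)
      induction e with
      | _ a b =>
        refine .contractEdge a b hab _ hq.surjective (fun x y => ?_) hq.adj_iff hq.map_root
        refine φ.injective.eq_iff.trans (contractMap_eq_contractMap_iff.trans ?_)
        simp

theorem step_deleteEdge {e : Sym2 R.V} (he : e ∈ R.graph.edgeSet) : Step R (R.deleteEdge e) :=
  step_iff.2 (.inl ⟨e, he, .refl _⟩)

theorem step_deleteVertex {v : R.V} (hv : v ≠ R.root) : Step R (R.deleteVertex v hv) :=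
  step_iff.2 (.inr (.inl ⟨v, hv, .refl _⟩))

theorem step_contract {e : Sym2 R.V} (he : e ∈ R.graph.edgeSet) : Step R (R.contract e) :=
  step_iff.2 (.inr (.inr ⟨e, he, .refl _⟩))

theorem Step.isIso_right (h : Step R S) (hS : S.IsIso T) : Step R T := by
  rw [step_iff] at h ⊢
  refine h.imp ?_ (Or.imp ?_ ?_)
  · exact fun ⟨e, he, hR⟩ => ⟨e, he, hS.symm.trans hR⟩
  · exact fun ⟨v, hv, hR⟩ => ⟨v, hv, hS.symm.trans hR⟩
  · exact fun ⟨e, he, hR⟩ => ⟨e, he, hS.symm.trans hR⟩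

theorem Step.isIso_left (h : Step R F) (hR : R.IsIso S) : Step S F := by
  obtain ⟨φ, hφ⟩ := hR
  have hmem : ∀ {e : Sym2 R.V}, e ∈ R.graph.edgeSet → e.map φ ∈ S.graph.edgeSet :=
    φ.map_mem_edgeSet_iff.2
  obtain ⟨e, he, hF⟩ | ⟨v, hv, hF⟩ | ⟨e, he, hF⟩ := step_iff.1 h
  · refine (step_deleteEdge (hmem he)).isIso_right (hF.trans ?_).symm
    refine isIso_of_bijective (S := S.deleteEdge (e.map φ)) φ.bijective (fun (p q : R.V) => ?_) hφ
    change (S.graph.deleteEdges _).Adj _ _ ↔ (R.graph.deleteEdges _).Adj _ _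
    rw [SimpleGraph.deleteEdges_adj, SimpleGraph.deleteEdges_adj, φ.map_adj_iff, ← Sym2.map_mk,
      Set.mem_singleton_iff, (Sym2.map.injective φ.injective).eq_iff, Set.mem_singleton_iff]
  · have hv' : φ v ≠ S.root := hφ ▸ φ.injective.ne hv
    refine (step_deleteVertex hv').isIso_right (hF.trans ?_).symm
    exact ⟨⟨φ.toEquiv.subtypeEquiv fun w => (φ.injective.ne_iff (x := w) (y := v)).symm,
      φ.map_adj_iff⟩, Subtype.ext hφ⟩
  · refine (step_contract (hmem he)).isIso_right (hF.trans ?_).symm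
    have hq := (isQuotientMap_contractMap S (e.map φ)).comp (isQuotientMap_iso hφ)
    refine (hq.isIso_contract fun x y => ?_).symm
    refine contractMap_eq_contractMap_iff.trans ?_
    rw [φ.injective.eq_iff, ← Sym2.map_mk, (Sym2.map.injective φ.injective).eq_iff]

theorem IsProperMinor.isIso_left (h : F.IsProperMinor R) (hF : F.IsIso T) : T.IsProperMinor R := by
  cases h with
  | single h => exact .single (h.isIso_right hF)
  | tail h h' => exact h.tail (h'.isIso_right hF)

theorem IsProperMinor.isIso_right (h : F.IsProperMinor R) (hR : R.IsIso S) :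
    F.IsProperMinor S := by
  obtain ⟨Q, h1, h2⟩ := Relation.TransGen.head'_iff.1 h
  exact Relation.TransGen.head'_iff.2 ⟨Q, h1.isIso_left hR, h2⟩

theorem reflTransGen_step_of_le (R : RootedGraph.{u}) {G : SimpleGraph R.V} (h : G ≤ R.graph) :
    Relation.ReflTransGen Step R { R with graph := G } := by
  obtain ⟨V, H, r⟩ := R
  dsimp only at G h ⊢
  induction H using WellFoundedLT.induction with
  | ind H ih =>
    obtain rfl | hlt := h.eq_or_lt
    · exact .refl
    obtain ⟨e, heH, heG⟩ := Set.exists_of_ssubset (SimpleGraph.edgeSet_ssubset_edgeSet.2 hlt)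
    have hle : G ≤ H.deleteEdges {e} := by
      rw [← SimpleGraph.edgeSet_subset_edgeSet, SimpleGraph.edgeSet_deleteEdges]
      exact Set.subset_sdiff_singleton (SimpleGraph.edgeSet_subset_edgeSet.2 h) heG
    have hlt : H.deleteEdges {e} < H := by
      rw [← SimpleGraph.edgeSet_ssubset_edgeSet, SimpleGraph.edgeSet_deleteEdges]
      exact Set.sdiff_singleton_ssubset.2 heH
    exact (ih _ hlt hle).head (step_deleteEdge (R := ⟨V, H, r⟩) heH)

end Operations

end RootedGraph

namespace RootedGraph

section ExtendRoot

variable {R S T F : RootedGraph.{u}}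

/-- The inclusion of a rooted graph into its root extension. -/
def incl (S : RootedGraph.{u}) : S.V → S.extendRoot.V := some

/-- The map on a root extension with given value at the root and given restriction. -/
def extendMap {α : Type*} (r : α) (g : S.V → α) : S.extendRoot.V → α := fun p => Option.elim p r g

@[simp] theorem extendMap_root {α : Type*} (r : α) (g : S.V → α) :
    extendMap r g S.extendRoot.root = r := rfl

@[simp] theorem extendMap_incl {α : Type*} (r : α) (g : S.V → α) (a : S.V) :
    extendMap r g (S.incl a) = g a := rfl

theorem incl_injective (S : RootedGraph.{u}) : Function.Injective S.incl := Option.some_injective _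

@[simp] theorem incl_inj {a b : S.V} : S.incl a = S.incl b ↔ a = b := S.incl_injective.eq_iff

@[simp] theorem incl_ne_root (a : S.V) : S.incl a ≠ S.extendRoot.root := Option.some_ne_none a

@[simp] theorem root_ne_incl (a : S.V) : S.extendRoot.root ≠ S.incl a := (incl_ne_root a).symm

theorem forall_extendRoot {p : S.extendRoot.V → Prop} :
    (∀ x, p x) ↔ p S.extendRoot.root ∧ ∀ a, p (S.incl a) := Option.forall

theorem eq_root_or_incl (x : S.extendRoot.V) : x = S.extendRoot.root ∨ ∃ a, S.incl a = x := by
  revert x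
  simp [forall_extendRoot]

theorem exists_extendRoot {p : S.extendRoot.V → Prop} :
    (∃ x, p x) ↔ p S.extendRoot.root ∨ ∃ a, p (S.incl a) := Option.exists

@[simp] theorem extendRoot_adj_incl (a b : S.V) :
    S.extendRoot.graph.Adj (S.incl a) (S.incl b) ↔ S.graph.Adj a b := by
  change (S.graph.map some ⊔ SimpleGraph.edge none (some S.root)).Adj (some a) (some b) ↔ _
  simpa [SimpleGraph.edge_adj, SimpleGraph.map_adj'] using fun h => h.ne

@[simp] theorem extendRoot_adj_root_incl (a : S.V) :
    S.extendRoot.graph.Adj S.extendRoot.root (S.incl a) ↔ a = S.root := by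
  change (S.graph.map some ⊔ SimpleGraph.edge none (some S.root)).Adj none (some a) ↔ _
  simp [SimpleGraph.edge_adj, SimpleGraph.map_adj', eq_comm]

@[simp] theorem extendRoot_adj_incl_root (a : S.V) :
    S.extendRoot.graph.Adj (S.incl a) S.extendRoot.root ↔ a = S.root := by
  rw [SimpleGraph.adj_comm, extendRoot_adj_root_incl]

theorem map_incl_mem_edgeSet {e : Sym2 S.V} (he : e ∈ S.graph.edgeSet) :
    e.map S.incl ∈ S.extendRoot.graph.edgeSet := by
  induction e with
  | _ a b => simpa using he

theorem root_incl_mem_edgeSet (S : RootedGraph.{u}) :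
    s(S.extendRoot.root, S.incl S.root) ∈ S.extendRoot.graph.edgeSet := by
  simp

theorem eq_or_exists_of_mem_edgeSet_extendRoot {e : Sym2 S.extendRoot.V}
    (he : e ∈ S.extendRoot.graph.edgeSet) :
    e = s(S.extendRoot.root, S.incl S.root) ∨ ∃ e' ∈ S.graph.edgeSet, e'.map S.incl = e := by
  induction e with
  | _ x y =>
    revert x y
    simp only [forall_extendRoot]
    refine ⟨⟨?_, ?_⟩, fun a => ⟨?_, fun b he => .inr ⟨s(a, b), ?_⟩⟩⟩ <;> simp_all

theorem isIso_extendRoot (g : T.V → F.V) (hinj : g.Injective)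
    (hroot : ∀ x, x ≠ F.root ↔ ∃ a, g a = x)
    (hadj : ∀ a b, F.graph.Adj (g a) (g b) ↔ T.graph.Adj a b)
    (hnbr : ∀ a, F.graph.Adj F.root (g a) ↔ a = T.root) : F.IsIso T.extendRoot := by
  have hne : ∀ a, g a ≠ F.root := fun a => (hroot _).2 ⟨a, rfl⟩
  have hf : Function.Bijective (extendMap F.root g) := by
    constructor
    · simp [Function.Injective, forall_extendRoot, hne, (hne _).symm, hinj.eq_iff]
    · exact fun x => exists_extendRoot.2 ((eq_or_ne x F.root).imp Eq.symm (hroot x).1)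
  refine (isIso_of_bijective hf ?_ rfl).symm
  simp [forall_extendRoot, hadj, hnbr, F.graph.adj_comm (g _)]

theorem IsIso.extendRoot (h : S.IsIso T) : S.extendRoot.IsIso T.extendRoot := by
  obtain ⟨e, he⟩ := h.symm
  refine isIso_extendRoot (S.incl ∘ e) (S.incl_injective.comp e.injective) ?_ ?_ ?_
  · simpa [forall_extendRoot, Function.Surjective] using e.surjective
  · simpa using fun a b => e.map_adj_iff
  · simp [← he]

@[simp] theorem mk_incl_eq_map_incl_iff {a b : S.V} {e : Sym2 S.V} :
    s(S.incl a, S.incl b) = e.map S.incl ↔ s(a, b) = e := by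
  rw [← Sym2.map_mk, (Sym2.map.injective S.incl_injective).eq_iff]

@[simp] theorem mk_root_ne_map_incl (x : S.extendRoot.V) (e : Sym2 S.V) :
    s(S.extendRoot.root, x) ≠ e.map S.incl := by
  induction e with
  | _ a b => simp

@[simp] theorem mk_root_ne_map_incl' (x : S.extendRoot.V) (e : Sym2 S.V) :
    s(x, S.extendRoot.root) ≠ e.map S.incl := by
  rw [Sym2.eq_swap]
  exact mk_root_ne_map_incl x e

theorem deleteEdge_adj {e : Sym2 R.V} {p q : R.V} :
    (R.deleteEdge e).graph.Adj p q ↔ R.graph.Adj p q ∧ s(p, q) ≠ e :=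
  SimpleGraph.deleteEdges_adj

theorem isIso_extendRoot_deleteEdge (S : RootedGraph.{u}) (e : Sym2 S.V) :
    (S.extendRoot.deleteEdge (e.map S.incl)).IsIso (S.deleteEdge e).extendRoot := by
  refine isIso_extendRoot (T := S.deleteEdge e) S.incl S.incl_injective ?_
    (fun (a b : S.V) => ?_) (fun a : S.V => ?_)
  · exact forall_extendRoot.2 (by simp [deleteEdge])
  · refine deleteEdge_adj.trans (Iff.trans ?_ deleteEdge_adj.symm)
    simp
  · refine deleteEdge_adj.trans ?_
    simp [deleteEdge]

theorem isIso_extendRoot_deleteVertex {v : S.V} (hv : v ≠ S.root) :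
    (S.extendRoot.deleteVertex (S.incl v) (incl_ne_root v)).IsIso
      (S.deleteVertex v hv).extendRoot := by
  refine isIso_extendRoot (T := S.deleteVertex v hv)
    (fun w : {w // w ≠ v} => ⟨S.incl w, S.incl_injective.ne w.2⟩) (fun x y h => ?_) ?_ ?_ ?_
  · exact Subtype.ext (S.incl_injective (congrArg Subtype.val h))
  · rintro ⟨x, hx⟩
    obtain rfl | ⟨x, rfl⟩ := eq_root_or_incl x
    · simp [deleteVertex]
    · refine iff_of_true (fun h => ?_) ⟨⟨x, fun h => hx (congrArg _ h)⟩, rfl⟩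
      exact incl_ne_root x (congrArg Subtype.val h)
  · exact fun _ _ => extendRoot_adj_incl _ _
  · exact fun w => (extendRoot_adj_root_incl _).trans
      (Subtype.ext_iff (a1 := w) (a2 := (S.deleteVertex v hv).root)).symm

theorem IsQuotientMap.extendRoot {f : S.V → T.V} (hf : IsQuotientMap f) :
    IsQuotientMap (extendMap T.extendRoot.root (T.incl ∘ f)) where
  surjective := by
    simpa [Function.Surjective, forall_extendRoot, exists_extendRoot] using hf.surjective
  adj_iff := by
    simp [forall_extendRoot, exists_extendRoot, hf.adj_iff, hf.map_root, eq_comm]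
  map_root := rfl

theorem isQuotientMap_extendMap_id (S : RootedGraph.{u}) :
    IsQuotientMap (R := S.extendRoot) (S := S) (extendMap S.root id) where
  surjective x := ⟨S.incl x, rfl⟩
  adj_iff x y := by
    have hne : S.graph.Adj x y → x ≠ y := SimpleGraph.Adj.ne
    simp only [exists_extendRoot, extendMap_root, extendMap_incl, extendRoot_adj_incl,
      extendRoot_adj_root_incl, extendRoot_adj_incl_root, id_eq, SimpleGraph.irrefl]
    grind
  map_root := rfl

theorem isIso_extendRoot_contract (S : RootedGraph.{u}) (e : Sym2 S.V) :
    (S.extendRoot.contract (e.map S.incl)).IsIso (S.contract e).extendRoot := by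
  refine ((isQuotientMap_contractMap S e).extendRoot.isIso_contract ?_).symm
  simp [forall_extendRoot, contractMap_eq_contractMap_iff]

theorem isIso_contract_root (S : RootedGraph.{u}) :
    S.IsIso (S.extendRoot.contract s(S.extendRoot.root, S.incl S.root)) := by
  refine (isQuotientMap_extendMap_id S).isIso_contract ?_
  simp [forall_extendRoot, eq_comm]

theorem step_extendRoot_self (S : RootedGraph.{u}) : Step S.extendRoot S :=
  (step_contract S.root_incl_mem_edgeSet).isIso_right (isIso_contract_root S).symm

theorem Step.extendRoot (h : Step S T) : Step S.extendRoot T.extendRoot := by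
  obtain ⟨e, he, hT⟩ | ⟨v, hv, hT⟩ | ⟨e, he, hT⟩ := step_iff.1 h
  · exact (step_deleteEdge (map_incl_mem_edgeSet he)).isIso_right
      ((isIso_extendRoot_deleteEdge S e).trans hT.symm.extendRoot)
  · exact (step_deleteVertex (incl_ne_root v)).isIso_right
      ((isIso_extendRoot_deleteVertex hv).trans hT.symm.extendRoot)
  · exact (step_contract (map_incl_mem_edgeSet he)).isIso_right
      ((isIso_extendRoot_contract S e).trans hT.symm.extendRoot)

/-- The root has no neighbors. -/
def IsRootIsolated (R : RootedGraph.{u}) : Prop := ∀ v, ¬ R.graph.Adj R.root v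

theorem IsRootIsolated.of_isIso (h : S.IsRootIsolated) (e : R.IsIso S) : R.IsRootIsolated := by
  obtain ⟨e, he⟩ := e
  intro v hv
  rw [← e.map_adj_iff, he] at hv
  exact h _ hv

theorem IsRootIsolated.of_step (hR : R.IsRootIsolated) (h : Step R S) : S.IsRootIsolated := by
  intro v hv
  cases h with
  | deleteEdge a b hab e he =>
    rw [← e.map_adj_iff, he, SimpleGraph.deleteEdges_adj] at hv
    exact hR _ hv.1
  | deleteVertex w hw e he =>
    rw [← e.map_adj_iff, SimpleGraph.induce_adj, he] at hv
    exact hR _ hv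
  | contractEdge a b hab f hf hfib hadj hroot =>
    obtain ⟨-, p, q, hp, -, hpq⟩ := (hadj _ _).1 hv
    rw [← hroot, hfib] at hp
    obtain rfl | ⟨rfl, rfl⟩ | ⟨rfl, rfl⟩ := hp
    · exact hR _ hpq
    · exact hR _ hab.symm
    · exact hR _ hab

theorem isRootIsolated_deleteEdge_root (S : RootedGraph.{u}) :
    (S.extendRoot.deleteEdge s(S.extendRoot.root, S.incl S.root)).IsRootIsolated := by
  intro v hv
  obtain ⟨hadj, hne⟩ := deleteEdge_adj.1 hv
  obtain rfl | ⟨v, rfl⟩ := eq_root_or_incl v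
  · exact hadj.ne rfl
  · exact hne (by rw [(extendRoot_adj_root_incl v).1 hadj]; rfl)

theorem isRootIsolated_deleteVertex_root (S : RootedGraph.{u}) :
    (S.extendRoot.deleteVertex (S.incl S.root) (incl_ne_root _)).IsRootIsolated := by
  rintro ⟨v, hv⟩ (hadj : S.extendRoot.graph.Adj S.extendRoot.root v)
  obtain rfl | ⟨v, rfl⟩ := eq_root_or_incl v
  · exact hadj.ne rfl
  · exact hv (congrArg S.incl ((extendRoot_adj_root_incl v).1 hadj))

theorem Step.of_extendRoot (h : Step S.extendRoot F) :
    (∃ T, Step S T ∧ F.IsIso T.extendRoot) ∨ F.IsIso S ∨ F.IsRootIsolated := by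
  obtain ⟨e, he, hF⟩ | ⟨v, hv, hF⟩ | ⟨e, he, hF⟩ := step_iff.1 h
  · obtain rfl | ⟨e, he', rfl⟩ := eq_or_exists_of_mem_edgeSet_extendRoot he
    · exact .inr (.inr ((isRootIsolated_deleteEdge_root S).of_isIso hF))
    · exact .inl ⟨_, step_deleteEdge he', hF.trans (isIso_extendRoot_deleteEdge S e)⟩
  · obtain rfl | ⟨v, rfl⟩ := eq_root_or_incl v
    · exact absurd rfl hv
    by_cases hvr : v = S.root
    · subst hvr
      exact .inr (.inr ((isRootIsolated_deleteVertex_root S).of_isIso hF))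
    · exact .inl ⟨_, step_deleteVertex hvr, hF.trans (isIso_extendRoot_deleteVertex hvr)⟩
  · obtain rfl | ⟨e, he', rfl⟩ := eq_or_exists_of_mem_edgeSet_extendRoot he
    · exact .inr (.inl (hF.trans (isIso_contract_root S).symm))
    · exact .inl ⟨_, step_contract he', hF.trans (isIso_extendRoot_contract S e)⟩

theorem IsProperMinor.of_extendRoot (h : F.IsProperMinor S.extendRoot) :
    (∃ T : RootedGraph.{u}, T.IsProperMinor S ∧ F.IsIso T.extendRoot) ∨
      (∃ T, Relation.ReflTransGen Step S T ∧ F.IsIso T) ∨ F.IsRootIsolated := by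
  induction h with
  | single h =>
    obtain ⟨T, hT, hF⟩ | hF | hF := h.of_extendRoot
    · exact Or.inl ⟨T, .single hT, hF⟩
    · exact Or.inr (Or.inl ⟨S, .refl, hF⟩)
    · exact Or.inr (Or.inr hF)
  | tail _ h ih =>
    obtain ⟨T, hT, hF⟩ | ⟨T, hT, hF⟩ | hF := ih
    · obtain ⟨T', hT', hF'⟩ | hF' | hF' := (h.isIso_left hF).of_extendRoot
      · exact Or.inl ⟨T', hT.tail hT', hF'⟩
      · exact Or.inr (Or.inl ⟨T, hT.to_reflTransGen, hF'⟩)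
      · exact Or.inr (Or.inr hF')
    · exact Or.inr (Or.inl ⟨_, hT.tail (h.isIso_left hF), .refl _⟩)
    · exact Or.inr (Or.inr (hF.of_step h))

theorem IsProperMinor.extendRoot (h : T.IsProperMinor S) :
    T.extendRoot.IsProperMinor S.extendRoot :=
  Relation.TransGen.lift (p := Step) RootedGraph.extendRoot (fun _ _ h => Step.extendRoot h) _ _ h

end ExtendRoot

end RootedGraph

namespace RootedGraph

variable {R S F : RootedGraph.{u}} {k l : ℕ}

theorem IsRootIsolated.not_allowsSNIP_add_one (hR : R.IsRootIsolated) :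
    ¬ R.AllowsSNIP k (k + 1) := by
  intro h
  obtain ⟨j, hj, -⟩ := h.exists_deleteRoot
  exact hR _ hj

theorem isIso_deleteRoot_extendRoot (S : RootedGraph.{u}) :
    S.IsIso (S.extendRoot.deleteRoot ⟨S.incl S.root, incl_ne_root _⟩) := by
  refine isIso_of_bijective (S := S.extendRoot.deleteRoot _)
    (f := fun a => ⟨S.incl a, incl_ne_root a⟩) ⟨fun a b h => ?_, ?_⟩ extendRoot_adj_incl rfl
  · exact S.incl_injective (congrArg Subtype.val h)
  · rintro ⟨x, hx⟩
    obtain ⟨a, rfl⟩ := (eq_root_or_incl x).resolve_left hx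
    exact ⟨a, rfl⟩

theorem extendRoot_allowsSNIP_add_one_iff :
    S.extendRoot.AllowsSNIP k (k + 1) ↔ S.AllowsSNIP k k := by
  have hiso := isIso_deleteRoot_extendRoot S
  constructor
  · intro h
    obtain ⟨⟨x, hx⟩, hadj, hk⟩ := h.exists_deleteRoot
    obtain ⟨a, rfl⟩ := (eq_root_or_incl x).resolve_left hx
    obtain rfl := (extendRoot_adj_root_incl a).1 hadj
    exact hk.of_isIso hiso
  · exact fun h => (h.of_isIso hiso.symm).of_deleteRoot ((extendRoot_adj_root_incl _).2 rfl)

theorem isIso_extendRoot_deleteRoot {j : {v // v ≠ R.root}} (hj : R.graph.Adj R.root j) :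
    IsIso { R with graph := R.graph.deleteEdges {e | R.root ∈ e ∧ e ≠ s(R.root, ↑j)} }
      (R.deleteRoot j).extendRoot := by
  refine isIso_extendRoot (T := R.deleteRoot j) Subtype.val Subtype.val_injective ?_ ?_ ?_
  · intro x
    simp [deleteRoot]
  · intro (a : {v // v ≠ R.root}) (b : {v // v ≠ R.root})
    simp [deleteRoot, SimpleGraph.deleteEdges_adj, a.2.symm, b.2.symm]
  · intro (a : {v // v ≠ R.root})
    change (R.graph.deleteEdges _).Adj R.root a ↔ a = j
    rw [SimpleGraph.deleteEdges_adj]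
    constructor
    · rintro ⟨-, hne⟩
      exact Subtype.ext (by simpa [a.2] using hne)
    · rintro rfl
      exact ⟨hj, by simp⟩

theorem isIso_or_isProperMinor_extendRoot_deleteRoot {j : {v // v ≠ R.root}}
    (hj : R.graph.Adj R.root j) :
    R.IsIso (R.deleteRoot j).extendRoot ∨ (R.deleteRoot j).extendRoot.IsProperMinor R := by
  have hiso := isIso_extendRoot_deleteRoot hj
  obtain heq | h := Relation.reflTransGen_iff_eq_or_transGen.1
    (R.reflTransGen_step_of_le (SimpleGraph.deleteEdges_le {e | R.root ∈ e ∧ e ≠ s(R.root, ↑j)}))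
  · rw [heq] at hiso
    exact .inl hiso
  · exact .inr (IsProperMinor.isIso_left h hiso)

theorem isProperMinor_deleteRoot {j : {v // v ≠ R.root}} (hj : R.graph.Adj R.root j) :
    (R.deleteRoot j).IsProperMinor R := by
  have hstep := step_extendRoot_self (R.deleteRoot j)
  obtain hR | hR := isIso_or_isProperMinor_extendRoot_deleteRoot hj
  · exact .single (hstep.isIso_left hR.symm)
  · exact .tail hR hstep

theorem AllowsSNIP.le_add_one (h : R.AllowsSNIP k l) : l ≤ k + 1 := by
  classical
  obtain ⟨A, hA, rfl, rfl, -⟩ := h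
  exact nullity_deleteIndex_le_nullity_add_one hA.1

theorem add_le_xixi (hkl : k ≤ l) (h : R.AllowsSNIP k l) : k + l ≤ R.xixi :=
  R.isGreatest_xixi.2 ⟨k, l, hkl, h, rfl⟩

theorem exists_allowsSNIP_xixi_eq (R : RootedGraph.{u}) :
    ∃ m, R.AllowsSNIP m m ∧ R.xixi = 2 * m ∨ R.AllowsSNIP m (m + 1) ∧ R.xixi = 2 * m + 1 := by
  obtain ⟨p, q, hpq, hR, hs⟩ := R.isGreatest_xixi.1
  obtain rfl | rfl : q = p ∨ q = p + 1 := by grind [hR.le_add_one]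
  · exact ⟨q, .inl ⟨hR, by omega⟩⟩
  · exact ⟨p, .inr ⟨hR, by omega⟩⟩

theorem two_mul_le_xixi_iff :
    2 * k ≤ R.xixi ↔ ∃ m, k ≤ m ∧ (R.AllowsSNIP m m ∨ R.AllowsSNIP m (m + 1)) := by
  constructor
  · intro h
    obtain ⟨m, ⟨hR, hm⟩ | ⟨hR, hm⟩⟩ := R.exists_allowsSNIP_xixi_eq
    · exact ⟨m, by omega, .inl hR⟩
    · exact ⟨m, by omega, .inr hR⟩
  · rintro ⟨m, hm, h | h⟩
    · exact le_trans (by omega) (add_le_xixi le_rfl h)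
    · exact le_trans (by omega) (add_le_xixi (Nat.le_add_right m 1) h)

theorem two_mul_add_one_le_xixi_iff :
    2 * k + 1 ≤ R.xixi ↔ ∃ m, k ≤ m ∧ R.AllowsSNIP m (m + 1) := by
  constructor
  · intro h
    obtain ⟨m, ⟨hR, hm⟩ | ⟨hR, hm⟩⟩ := R.exists_allowsSNIP_xixi_eq
    · obtain ⟨m, rfl⟩ : ∃ m', m = m' + 1 := ⟨m - 1, by omega⟩
      exact ⟨m, by omega, hR.pred_left⟩
    · exact ⟨m, by omega, hR⟩
  · rintro ⟨m, hm, h⟩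
    exact le_trans (by omega) (add_le_xixi (Nat.le_add_right m 1) h)

theorem IsIso.xixi_eq (h : R.IsIso S) : R.xixi = S.xixi := by
  have hpair : R.pairSums = S.pairSums := by
    ext s
    exact exists₂_congr fun k l => and_congr_right fun _ => and_congr_left fun _ =>
      ⟨fun hR => hR.of_isIso h.symm, fun hS => hS.of_isIso h⟩
  rw [xixi, xixi, hpair]

theorem exists_minor_two_mul_le_xixi (h : 2 * k ≤ S.xixi) :
    ∃ Q, Relation.ReflTransGen Step S Q ∧ 2 * k ≤ Q.xixi ∧ 2 * k + 1 ≤ Q.extendRoot.xixi := by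
  obtain ⟨m, Q, hm, hSQ, hQ⟩ :
      ∃ m Q, k ≤ m ∧ Relation.ReflTransGen Step S Q ∧ Q.AllowsSNIP m m := by
    obtain ⟨m, hm, hS | hS⟩ := two_mul_le_xixi_iff.1 h
    · exact ⟨m, S, hm, .refl, hS⟩
    · obtain ⟨j, hj, hm'⟩ := hS.exists_deleteRoot
      exact ⟨m, _, hm, (isProperMinor_deleteRoot hj).to_reflTransGen, hm'⟩
  exact ⟨Q, hSQ, two_mul_le_xixi_iff.2 ⟨m, hm, .inl hQ⟩,
    two_mul_add_one_le_xixi_iff.2 ⟨m, hm, extendRoot_allowsSNIP_add_one_iff.2 hQ⟩⟩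

theorem IsProperMinor.exists_two_mul_le_xixi_of_extendRoot (h : F.IsProperMinor S.extendRoot)
    (hF : 2 * k + 1 ≤ F.xixi) : ∃ Q : RootedGraph.{u}, Q.IsProperMinor S ∧ 2 * k ≤ Q.xixi := by
  obtain ⟨m, hm, hFm⟩ := two_mul_add_one_le_xixi_iff.1 hF
  obtain ⟨T, hT, hFT⟩ | ⟨T, hT, hFT⟩ | hF' := h.of_extendRoot
  · have hTm := extendRoot_allowsSNIP_add_one_iff.1 (hFm.of_isIso hFT.symm)
    exact ⟨T, hT, two_mul_le_xixi_iff.2 ⟨m, hm, .inl hTm⟩⟩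
  · obtain ⟨j, hj, hQ⟩ := (hFm.of_isIso hFT.symm).exists_deleteRoot
    exact ⟨_, .trans_right hT (isProperMinor_deleteRoot hj),
      two_mul_le_xixi_iff.2 ⟨m, hm, .inl hQ⟩⟩
  · exact absurd hFm hF'.not_allowsSNIP_add_one

theorem exists_isIso_or_isProperMinor_extendRoot (h : 2 * k + 1 ≤ R.xixi) :
    ∃ S : RootedGraph.{u}, 2 * k ≤ S.xixi ∧ 2 * k + 1 ≤ S.extendRoot.xixi ∧
      (R.IsIso S.extendRoot ∨ S.extendRoot.IsProperMinor R) := by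
  obtain ⟨m, hm, hR⟩ := two_mul_add_one_le_xixi_iff.1 h
  obtain ⟨j, hj, hS⟩ := hR.exists_deleteRoot
  exact ⟨R.deleteRoot j, two_mul_le_xixi_iff.2 ⟨m, hm, .inl hS⟩,
    two_mul_add_one_le_xixi_iff.2 ⟨m, hm, extendRoot_allowsSNIP_add_one_iff.2 hS⟩,
    isIso_or_isProperMinor_extendRoot_deleteRoot hj⟩

end RootedGraph

theorem mainTheorem3 (k : ℕ) (R : RootedGraph.{u}) :
    R.IsMinimalMinor (2 * k + 1) ↔
      ∃ S : RootedGraph.{u}, S.IsMinimalMinor (2 * k) ∧ R.IsIso S.extendRoot := by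
  constructor
  · rintro ⟨hR, hmin⟩
    obtain ⟨S, hS, hS', hiso | hminor⟩ := RootedGraph.exists_isIso_or_isProperMinor_extendRoot hR
    · refine ⟨S, ⟨hS, fun T hT => lt_of_not_ge fun hTk => ?_⟩, hiso⟩
      obtain ⟨Q, hTQ, -, hQ⟩ := RootedGraph.exists_minor_two_mul_le_xixi hTk
      have hQS : Q.IsProperMinor S := Relation.TransGen.trans_left hT hTQ
      exact (hmin _ (hQS.extendRoot.isIso_right hiso.symm)).not_ge hQ
    · exact absurd hS' (hmin _ hminor).not_ge
  · rintro ⟨S, ⟨hS, hmin⟩, hiso⟩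
    constructor
    · obtain ⟨Q, hSQ, hQ, hQ'⟩ := RootedGraph.exists_minor_two_mul_le_xixi hS
      obtain rfl | hQS := Relation.reflTransGen_iff_eq_or_transGen.1 hSQ
      · rwa [hiso.xixi_eq]
      · exact absurd hQ (hmin Q hQS).not_ge
    · refine fun F hF => lt_of_not_ge fun hFk => ?_
      obtain ⟨Q, hQS, hQ⟩ := (hF.isIso_right hiso).exists_two_mul_le_xixi_of_extendRoot hFk
      exact (hmin Q hQS).not_ge hQ
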